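/- **Setting.** Let $r:\mathbb R\to(0,\infty)$ be $C^1$ and $2\pi$-periodic, let $\gamma=\{r(s)e^{is}:s\in\mathbb R\}$ be the corresponding smooth Jordan curve, starlike with respect to the origin, and let $\Omega=\{qe^{is}: 0\le q<r(s)\}$ be the domain that it bounds. For $s\in\mathbb R$ let $\alpha_s\in(0,\pi)$ be the angle between $r(s)e^{is}$ and the positively oriented tangent of $\gamma$ at this point, that is, $\cos\alpha_s=r'(s)/\sqrt{r(s)^2+r'(s)^2}$, and put $\alpha_\gamma=\min\{\min_s\alpha_s,\ \pi-\max_s\alpha_s\}$. Let $\mathbf T$ be the unit circle and $\mathbf U$ the open unit disk. Let $G:\mathbf T\to\gamma$ be an orientation-preserving homeomorphism, written as $G(e^{it})=\rho(t)e^{i\psi(t)}$ with $\rho>0$ and $\psi:\mathbb R\to\mathbb R$ continuous and increasing. Let $w(z)=|z|\,G(z/|z|)$, $w(0)=0$, be its radial extension $\mathbf U\to\Omega$. A map $f$ between metric spaces is $(\ell,\mathcal L)$-bi-Lipschitz, where $0<\ell\le\mathcal L<\infty$, if $\ell\, d(x,y)\le d(f(x),f(y))\le\mathcal L\, d(x,y)$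 for all $x,y$; it is bi-Lipschitz if this holds for some such $\ell,\mathcal L$. Subsets of the plane carry the Euclidean distance. For $0\le k<1$, the map $w$ is $k$-quasiconformal if it is a sense-preserving homeomorphism of $\mathbf U$ onto $\Omega$, its real and imaginary parts are absolutely continuous on lines (ACL) in $\mathbf U$, and $|w_{\bar z}|\le k\,|w_z|$ almost everywhere in $\mathbf U$; it is quasiconformal if it is $k$-quasiconformal for some $k\in[0,1)$. By $|\cdot|_\infty$ we denote the $L^\infty$ norm. **Theorem.** The following conditions are equivalent: * a) $G$ is bi-Lipschitz; * b) $\psi$ is bi-Lipschitz; * c) $w$ is bi-Lipschitz on $\mathbf U$; * d) $w$ is quasiconformal. Moreover, suppose that these conditions hold and let $L=\max\{|\psi'|_\infty,|1/\psi'|_\infty\}$. Then: (i) $w$ is $(\ell,\mathcal L)$-bi-Lipschitz on $\mathbf U$, where $$\mathcal L=\frac{|\rho|_\infty}{2\sin\alpha_\gamma}\left(\sqrt{L^2+\sin^2\alpha_\gamma(1-2L)}+\sqrt{L^2+\sin^2\alpha_\gamma(1+2L)}\right),\qquad \ell=\frac{\operatorname{dist}(\gamma,0)^2}{L\,\mathcal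 L}.$$ (ii) $w$ is $k$-quasiconformal, where $$k=\sqrt{\frac{L^2+\sin^2\alpha_\gamma(1-2L)}{L^2+\sin^2\alpha_\gamma(1+2L)}}.$$ Conversely, if $w$ is $k$-quasiconformal for some $k\in[0,1)$, then (i') $\psi$ is $\left(\frac{1-k}{1+k},\frac{1+k}{1-k}\right)$-bi-Lipschitz, and (ii') $\sin\alpha_\gamma\ge\frac{1-k}{1+k}$. -/

import Mathlib

open Complex Set MeasureTheory

noncomputable section

/-- An `(l, M)`-bi-Lipschitz map between metric spaces. -/
def IsBiLipschitzWith {X Y : Type*} [MetricSpace X] [MetricSpace Y] (l M : ℝ) (f : X → Y) : Prop :=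
  0 < l ∧ l ≤ M ∧ ∀ x y : X, l * dist x y ≤ dist (f x) (f y) ∧ dist (f x) (f y) ≤ M * dist x y

/-- A bi-Lipschitz map: `(l, M)`-bi-Lipschitz for some constants `0 < l ≤ M`. -/
def IsBiLipschitz {X Y : Type*} [MetricSpace X] [MetricSpace Y] (f : X → Y) : Prop :=
  ∃ l M : ℝ, IsBiLipschitzWith l M f

/-- The `L^∞` norm (essential supremum of the absolute value) of a real function on the line. -/
def linftyNorm (f : ℝ → ℝ) : ℝ := (eLpNorm f ⊤ volume).toReal

/-! ### Quasiconformal maps -/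

/-- A real function is absolutely continuous on lines in `D`: for every closed rectangle in `D`
with sides parallel to the axes, it is absolutely continuous on almost every horizontal and
almost every vertical segment of the rectangle. -/
def IsACL (u : ℂ → ℝ) (D : Set ℂ) : Prop :=
  ∀ a b c d : ℝ, a ≤ b → c ≤ d → Icc a b ×ℂ Icc c d ⊆ D →
    (∀ᵐ y : ℝ ∂volume.restrict (Icc c d),
      AbsolutelyContinuousOnInterval (fun x : ℝ => u (x + y * I)) a b) ∧
    (∀ᵐ x : ℝ ∂volume.restrict (Icc a b),
      AbsolutelyContinuousOnInterval (fun y : ℝ => u (x + y * I)) c d)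

/-- The partial derivative `w_x`. -/
def partialX (w : ℂ → ℂ) (z : ℂ) : ℂ := deriv (fun t : ℝ => w (z + t)) 0

/-- The partial derivative `w_y`. -/
def partialY (w : ℂ → ℂ) (z : ℂ) : ℂ := deriv (fun t : ℝ => w (z + t * I)) 0

/-- `w_z = (w_x + w_y / i) / 2`. -/
def wirtingerZ (w : ℂ → ℂ) (z : ℂ) : ℂ := (partialX w z + partialY w z / I) / 2

/-- `w_{z̄} = (w_x - w_y / i) / 2`. -/
def wirtingerZbar (w : ℂ → ℂ) (z : ℂ) : ℂ := (partialX w z - partialY w z / I) / 2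

/-- `w` restricts to a homeomorphism of the open set `D` onto the open set `Ω`. -/
def IsHomeoOnto (w : ℂ → ℂ) (D Ω : Set ℂ) : Prop :=
  ∃ e : OpenPartialHomeomorph ℂ ℂ, e.source = D ∧ e.target = Ω ∧ EqOn e w D

/-- Sense-preserving (for an injective continuous map on `D`): the image of every positively
oriented circle bounding a closed disk in `D` winds once, in the positive direction, around the
image of its centre. The winding is measured by a continuous branch `θ` of the argument. -/
def IsSensePreserving (w : ℂ → ℂ) (D : Set ℂ) : Prop :=
  ∀ z : ℂ, ∀ R : ℝ, 0 < R → Metric.closedBall z R ⊆ D →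
    ∃ θ : ℝ → ℝ, Continuous θ ∧
      (∀ t : ℝ, w (z + R * exp (t * I)) - w z =
        ‖w (z + R * exp (t * I)) - w z‖ * exp (θ t * I)) ∧
      θ (2 * Real.pi) - θ 0 = 2 * Real.pi

/-- `w` is a `k`-quasiconformal map of `D` onto `Ω`, where `0 ≤ k < 1`: a sense-preserving
homeomorphism, ACL in `D`, with complex dilatation bounded by `k` almost everywhere. -/
structure IsQuasiconformalWith (k : ℝ) (w : ℂ → ℂ) (D Ω : Set ℂ) : Prop where
  nonneg : 0 ≤ k
  lt_one : k < 1
  homeo : IsHomeoOnto w D Ω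
  sense : IsSensePreserving w D
  acl_re : IsACL (fun z => (w z).re) D
  acl_im : IsACL (fun z => (w z).im) D
  dilatation : ∀ᵐ z ∂volume.restrict D, ‖wirtingerZbar w z‖ ≤ k * ‖wirtingerZ w z‖

/-- `w` is quasiconformal if it is `k`-quasiconformal for some `0 ≤ k < 1`. -/
def IsQuasiconformal (w : ℂ → ℂ) (D Ω : Set ℂ) : Prop :=
  ∃ k : ℝ, IsQuasiconformalWith k w D Ω

/-! ### Smooth starlike Jordan curves -/

/-- `γ` is a smooth Jordan curve, starlike with respect to the origin, with polar
parametrization `s ↦ r(s) e^{is}`. -/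
structure IsSmoothStarlikeCurve (γ : Set ℂ) (r : ℝ → ℝ) : Prop where
  smooth : ContDiff ℝ 1 r
  periodic : Function.Periodic r (2 * Real.pi)
  pos : ∀ s, 0 < r s
  curve_eq : γ = range (fun s : ℝ => (r s : ℂ) * exp (s * I))

/-- The starlike Jordan domain bounded by the curve `s ↦ r(s) e^{is}`. -/
def starlikeDomain (r : ℝ → ℝ) : Set ℂ :=
  {z | ∃ s q : ℝ, 0 ≤ q ∧ q < r s ∧ z = q * exp (s * I)}

/-- The angle `α_s ∈ [0, π]` between `ζ = r(s) e^{is}` and the positively oriented tangent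
`(r'(s) + i r(s)) e^{is}` at `ζ`, given by `cos α_s = r'(s) / √(r(s)² + r'(s)²)`. -/
def tangentAngleAt (r : ℝ → ℝ) (s : ℝ) : ℝ :=
  Real.arccos (deriv r s / Real.sqrt (r s ^ 2 + deriv r s ^ 2))

/-- `α_γ = min {α₁, π - α₂}` with `α₁` the minimum and `α₂` the maximum of the angles `α_s`. -/
def tangentAngle (r : ℝ → ℝ) : ℝ :=
  min (⨅ s, tangentAngleAt r s) (Real.pi - ⨆ s, tangentAngleAt r s)

/-- The radial extension `w(z) = |z| F(z/|z|)`, `w(0) = 0`. -/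
def radialExtension (F : Circle → ℂ) (z : ℂ) : ℂ := ‖z‖ * F (Circle.exp (arg z))

/-- The point of the circle used in `radialExtension` is `z / |z|`. -/
theorem coe_circle_exp_arg {z : ℂ} (hz : z ≠ 0) : (Circle.exp (arg z) : ℂ) = z / ‖z‖ := by
  have h : (‖z‖ : ℂ) ≠ 0 := by simpa using hz
  rw [Circle.coe_exp, eq_div_iff h, mul_comm]
  exact norm_mul_exp_arg_mul_I z

end

/-! In logarithmic coordinates around `q e^{it}` the homogeneous map `w (q e^{it}) = q r(ψ t)
e^{iψ(t)}` has the formal differential `q r` times a rotation of the matrix `(1, λ cot α; 0, λ)`,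
where `λ = ψ'(t)` and `α` is the tangent angle at `ψ t`. All the constants are read off this matrix.

If `ψ` is bi-Lipschitz, then `λ` lies in `[1/L, L]`. The operator norm is then at most
`stretchBound`, and the determinant, at least `1/L`, turns this upper bound into a lower one
(`norm_sub_bounds_of_slopes`). Since `ψ` need not be differentiable everywhere, its difference
quotients play the role of `λ` (`eventually_exists_radialDeriv`). The pointwise bounds become global
by comparison along segments, applied to `w` and to its inverse. Both are taken on the whole plane,
because `Ω` need not be convex. The same matrix gives the dilatation almost everywhere
(`dilatation_le`).

Conversely, a dilatation bound `k` forces bounds on `ψ'` almost everywhere and on `cot α`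
(`bounds_of_dilatation`). Hence the partial derivatives of `w` are bounded almost everywhere, and
ACL makes `w` Lipschitz on a square containing the circle of radius 1/2. By homogeneity the boundary
map is Lipschitz, so `ψ` is too; only then may the sharp bounds on `ψ'` be integrated
(`isBiLipschitzWith_of_quasiconformal`). -/

noncomputable section

/-! ### From pointwise to global Lipschitz bounds. -/

section LocalToGlobal

open Filter Topology


/-- A map whose pointwise Lipschitz constant is everywhere at most `C` is `C`-Lipschitz. -/
theorem norm_sub_le_of_eventually_norm_sub_le {E F : Type*} [NormedAddCommGroup E]
    [NormedSpace ℝ E] [NormedAddCommGroup F] {f : E → F} {C : ℝ}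
    (h : ∀ x, ∀ ε > 0, ∀ᶠ y in 𝓝 x, ‖f y - f x‖ ≤ (C + ε) * ‖y - x‖) (x y : E) :
    ‖f y - f x‖ ≤ C * ‖y - x‖ := by
  rcases eq_or_ne y x with rfl | hne
  · simp
  have hD : 0 < ‖y - x‖ := norm_pos_iff.2 (sub_ne_zero.2 hne)
  have hcont : Continuous f := by
    refine continuous_iff_continuousAt.2 fun z => ?_
    refine tendsto_iff_norm_sub_tendsto_zero.2 ?_
    refine squeeze_zero' (Eventually.of_forall fun _ => norm_nonneg _) (h z 1 one_pos) ?_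
    have : Continuous fun y : E => (C + 1) * ‖y - z‖ := by fun_prop
    simpa using this.tendsto z
  set φ : ℝ → F := fun τ => f (x + τ • (y - x)) - f x with hφ
  have hφc : Continuous φ := by fun_prop
  have key : ∀ ε > 0, ‖f y - f x‖ ≤ (C + ε) * ‖y - x‖ := by
    intro ε hε
    -- Half of `ε` is kept back: the boundary comparison needs the slope of `‖φ‖` strictly below
    -- that of the barrier `(C + ε) ‖y - x‖ τ`.
    have hslope : ∀ τ ∈ Ico (0 : ℝ) 1, ∀ R, (C + ε / 2) * ‖y - x‖ < R →
        ∃ᶠ z in 𝓝[>] τ, slope (norm ∘ φ) τ z < R := by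
      intro τ _ R hR
      refine Eventually.frequently ?_
      have hl : Tendsto (fun σ : ℝ => x + σ • (y - x)) (𝓝[>] τ) (𝓝 (x + τ • (y - x))) :=
        (Continuous.tendsto (by fun_prop) τ).mono_left nhdsWithin_le_nhds
      filter_upwards [hl.eventually (h (x + τ • (y - x)) (ε / 2) (half_pos hε)),
        self_mem_nhdsWithin] with σ hσ (hτσ : τ < σ)
      have h1 : (x + σ • (y - x)) - (x + τ • (y - x)) = (σ - τ) • (y - x) := by
        rw [sub_smul]; abel
      rw [h1, norm_smul, Real.norm_of_nonneg (sub_nonneg.2 hτσ.le)] at hσ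
      have h2 : ‖φ σ‖ - ‖φ τ‖ ≤ (C + ε / 2) * ((σ - τ) * ‖y - x‖) := by
        refine (norm_sub_norm_le _ _).trans ?_
        simpa [hφ] using hσ
      rw [slope_def_field, div_lt_iff₀ (sub_pos.2 hτσ)]
      simp only [Function.comp_apply]
      nlinarith [sub_pos.2 hτσ]
    have := image_norm_le_of_liminf_right_slope_norm_lt_deriv_boundary (a := 0) (b := 1)
      (f := φ) (f' := fun _ => (C + ε / 2) * ‖y - x‖) hφc.continuousOn hslope
      (B := fun τ => (C + ε) * ‖y - x‖ * τ) (B' := fun _ => (C + ε) * ‖y - x‖)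
      (by simp [hφ]) (by fun_prop)
      (fun τ _ => by simpa using ((hasDerivAt_id τ).const_mul ((C + ε) * ‖y - x‖)).hasDerivWithinAt)
      (fun τ _ _ => by nlinarith) (right_mem_Icc.2 zero_le_one)
    simpa [hφ] using this
  refine le_of_forall_pos_le_add fun ε hε => ?_
  have := key (ε / ‖y - x‖) (by positivity)
  rwa [add_mul, div_mul_cancel₀ _ hD.ne'] at this

/-- A homeomorphism that expands distances locally by at least `c` does so globally. -/
theorem mul_norm_sub_le_of_eventually {E F : Type*} [NormedAddCommGroup E]
    [NormedAddCommGroup F] [NormedSpace ℝ F] (e : E ≃ₜ F) {c : ℝ} (hc : 0 < c)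
    (h : ∀ x, ∀ ε > 0, ∀ᶠ y in 𝓝 x, (c - ε) * ‖y - x‖ ≤ ‖e y - e x‖) (x y : E) :
    c * ‖y - x‖ ≤ ‖e y - e x‖ := by
  have key : ∀ u v : F, ‖e.symm v - e.symm u‖ ≤ c⁻¹ * ‖v - u‖ := by
    refine norm_sub_le_of_eventually_norm_sub_le fun u ε hε => ?_
    have hpos : 0 < c⁻¹ + ε := by positivity
    have hlt : (c⁻¹ + ε)⁻¹ < c := by
      rw [inv_lt_comm₀ hpos hc]; linarith
    -- The slack is chosen so that the expansion factor is exactly `(c⁻¹ + ε)⁻¹`, the reciprocal of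
    -- the factor wanted for the inverse.
    have := h (e.symm u) (c - (c⁻¹ + ε)⁻¹) (by linarith)
    filter_upwards [(e.symm.continuous.tendsto u).eventually this] with v hv
    simp only [sub_sub_cancel, Homeomorph.apply_symm_apply] at hv
    rwa [inv_mul_le_iff₀ hpos] at hv
  have := key (e x) (e y)
  simp only [Homeomorph.symm_apply_apply] at this
  rwa [← div_eq_inv_mul, le_div_iff₀' hc] at this

end LocalToGlobal

/-! ### Integrating almost everywhere derivative bounds. -/

section RealFunctions

open scoped NNReal

/-- Bounds on the derivative of a Lipschitz function that hold almost everywhere integrate. -/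
theorem LipschitzWith.mul_sub_le_of_ae_deriv {f : ℝ → ℝ} {K : ℝ≥0} (hf : LipschitzWith K f)
    {l M : ℝ} (h : ∀ᵐ t, l ≤ deriv f t ∧ deriv f t ≤ M) {x y : ℝ} (hxy : x ≤ y) :
    l * (y - x) ≤ f y - f x ∧ f y - f x ≤ M * (y - x) := by
  have hac : AbsolutelyContinuousOnInterval f x y :=
    (hf.lipschitzOnWith (s := uIcc x y)).absolutelyContinuousOnInterval
  have hi := hac.intervalIntegrable_deriv
  rw [← hac.integral_deriv_eq_sub]
  constructor
  · have := intervalIntegral.integral_mono_ae hxy (intervalIntegrable_const (c := l)) hi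
      (h.mono fun t ht => ht.1)
    simpa [mul_comm] using this
  · have := intervalIntegral.integral_mono_ae hxy hi (intervalIntegrable_const (c := M))
      (h.mono fun t ht => ht.2)
    simpa [mul_comm] using this

theorem AbsolutelyContinuousOnInterval.abs_sub_le_of_ae {f : ℝ → ℝ} {a b C : ℝ} (hab : a ≤ b)
    (hf : AbsolutelyContinuousOnInterval f a b)
    (h : ∀ᵐ t ∂volume.restrict (Icc a b), |deriv f t| ≤ C) : |f b - f a| ≤ C * (b - a) := by
  rw [← hf.integral_deriv_eq_sub]
  have := intervalIntegral.norm_integral_le_of_norm_le_const_ae (f := deriv f) (a := a) (b := b)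
    (C := C) ?_
  · rwa [abs_of_nonneg (sub_nonneg.2 hab)] at this
  · rw [ae_restrict_iff' measurableSet_Icc] at h
    filter_upwards [h] with t ht ht'
    rw [uIoc_of_le hab] at ht'
    exact ht ⟨ht'.1.le, ht'.2⟩

end RealFunctions

/-! ### Null sets in polar and Cartesian coordinates. -/

section Polar

open scoped Real ENNReal

/-- The Jacobian is positive on the polar chart, so a vanishing integral of an indicator forces the
pulled-back indicator to vanish almost everywhere. A measurable hull is used because `P` is
arbitrary. -/
theorem ae_comp_polarCoord_symm {P : ℂ → Prop} (h : ∀ᵐ z, P z) :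
    ∀ᵐ p ∂(volume.restrict polarCoord.target), P (Complex.polarCoord.symm p) := by
  set N := toMeasurable volume {z | ¬ P z} with hN
  have hNm : MeasurableSet N := measurableSet_toMeasurable _ _
  have hN0 : volume N = 0 := by rw [hN, measure_toMeasurable]; exact h
  have h1 := Complex.lintegral_comp_polarCoord_symm (N.indicator 1)
  rw [lintegral_indicator_one hNm, hN0] at h1
  have hmeas : Measurable fun p : ℝ × ℝ => Complex.polarCoord.symm p := by
    simp only [Complex.polarCoord_symm_apply]; fun_prop
  have hmeas2 : Measurable fun p : ℝ × ℝ =>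
      ENNReal.ofReal p.1 • N.indicator (1 : ℂ → ℝ≥0∞) (Complex.polarCoord.symm p) := by
    have h1 : Measurable (N.indicator (1 : ℂ → ℝ≥0∞)) := measurable_one.indicator hNm
    have h2 := h1.comp hmeas
    have h3 : Measurable fun p : ℝ × ℝ => ENNReal.ofReal p.1 := by fun_prop
    simpa [smul_eq_mul] using! h3.mul h2
  rw [lintegral_eq_zero_iff hmeas2] at h1
  filter_upwards [h1, ae_restrict_mem polarCoord.open_target.measurableSet] with p hp hpt
  by_contra hcon
  have hmem : Complex.polarCoord.symm p ∈ N := subset_toMeasurable _ _ hcon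
  have hp1 : 0 < p.1 := hpt.1
  have hp2 : ENNReal.ofReal p.1 = 0 := by
    simpa only [indicator_of_mem hmem, Pi.one_apply, smul_eq_mul, mul_one, Pi.zero_apply] using hp
  exact hp1.not_ge (ENNReal.ofReal_eq_zero.1 hp2)

/-- By Fubini in polar coordinates, rays with directions in a null set fill a null set. -/
theorem ae_arg_of_ae {Q : ℝ → Prop} (h : ∀ᵐ t, Q t) : ∀ᵐ z : ℂ, Q (arg z) := by
  set N := toMeasurable volume {t | ¬ Q t} with hN
  have hNm : MeasurableSet N := measurableSet_toMeasurable _ _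
  have hN0 : volume N = 0 := by rw [hN, measure_toMeasurable]; exact h
  have hSm : MeasurableSet (arg ⁻¹' N) := measurable_arg hNm
  suffices hS : volume (arg ⁻¹' N) = 0 from
    measure_mono_null (fun z hz => subset_toMeasurable volume {t | ¬ Q t} hz) hS
  rw [← lintegral_indicator_one hSm, ← Complex.lintegral_comp_polarCoord_symm]
  have hq : ∀ᵐ p : ℝ × ℝ, p.2 ∉ N :=
    (Measure.quasiMeasurePreserving_snd (μ := (volume : Measure ℝ))
      (ν := (volume : Measure ℝ))).ae (p := fun t => t ∉ N) (measure_eq_zero_iff_ae_notMem.1 hN0)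
  refine lintegral_eq_zero_of_ae_eq_zero ?_
  filter_upwards [ae_restrict_of_ae hq, ae_restrict_mem polarCoord.open_target.measurableSet]
    with p hp hpt
  have : arg (Complex.polarCoord.symm p) = p.2 := by
    rw [Complex.polarCoord_symm_apply, ofReal_cos, ofReal_sin]
    exact arg_mul_cos_add_sin_mul_I hpt.1 ⟨hpt.2.1, hpt.2.2.le⟩
  have hnot : Complex.polarCoord.symm p ∉ arg ⁻¹' N := by rwa [mem_preimage, this]
  rw [indicator_of_notMem hnot, smul_zero, Pi.zero_apply]

/-- Fubini on `(0,1) × (-π,π)` provides one radius on which the property holds for almost every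
angle. -/
theorem ae_of_ae_arg {Q : ℝ → Prop}
    (h : ∀ᵐ z : ℂ ∂volume.restrict (Metric.ball 0 1), z ≠ 0 → Q (arg z)) :
    ∀ᵐ t ∂volume.restrict (Ioo (-π) π), Q t := by
  rw [ae_restrict_iff' Metric.isOpen_ball.measurableSet] at h
  have h1 := ae_comp_polarCoord_symm h
  have h2 : ∀ᵐ p ∂((volume.restrict (Ioo (0 : ℝ) 1)).prod (volume.restrict (Ioo (-π) π))),
      Q p.2 := by
    rw [Measure.prod_restrict]
    have hsub : Ioo (0 : ℝ) 1 ×ˢ Ioo (-π) π ⊆ polarCoord.target :=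
      prod_mono (fun x hx => hx.1) subset_rfl
    filter_upwards [ae_restrict_of_ae_restrict_of_subset hsub h1,
      ae_restrict_mem (measurableSet_Ioo.prod measurableSet_Ioo)] with p hp hpt
    have harg : arg (Complex.polarCoord.symm p) = p.2 := by
      rw [Complex.polarCoord_symm_apply, ofReal_cos, ofReal_sin]
      exact arg_mul_cos_add_sin_mul_I hpt.1.1 ⟨hpt.2.1, hpt.2.2.le⟩
    have hn := Complex.norm_polarCoord_symm p
    rw [abs_of_pos hpt.1.1] at hn
    rw [← harg]
    refine hp (by simpa only [mem_ball_zero_iff, hn] using hpt.1.2) (norm_pos_iff.1 ?_)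
    rw [hn]; exact hpt.1.1
  have h3 := Measure.ae_ae_of_ae_prod h2
  have : (ae (volume.restrict (Ioo (0 : ℝ) 1))).NeBot := by
    rw [ae_neBot, Ne, Measure.restrict_eq_zero]; simp
  exact h3.exists.choose_spec

theorem ae_ae_of_ae_complex {P : ℂ → Prop} (h : ∀ᵐ z, P z) :
    (∀ᵐ y : ℝ, ∀ᵐ x : ℝ, P (x + y * I)) ∧ (∀ᵐ x : ℝ, ∀ᵐ y : ℝ, P (x + y * I)) := by
  have h1 : ∀ᵐ p : ℝ × ℝ, P (p.1 + p.2 * I) := by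
    have := Complex.volume_preserving_equiv_real_prod.symm.quasiMeasurePreserving.ae h
    filter_upwards [this] with p hp
    convert hp
    simp [Complex.ext_iff, measurableEquivRealProd]
  refine ⟨?_, Measure.ae_ae_of_ae_prod h1⟩
  have h2 : ∀ᵐ p : ℝ × ℝ, P (p.2 + p.1 * I) :=
    (Measure.measurePreserving_swap (μ := (volume : Measure ℝ))
      (ν := (volume : Measure ℝ))).quasiMeasurePreserving.ae h1
  exact Measure.ae_ae_of_ae_prod h2

end Polar

/-! ### Radial maps as homeomorphisms of the plane. -/

section Radial

open Filter Topology
open scoped Real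

/-- The point of the curve `s ↦ r(s) e^{is}`. -/
def polarPoint (r : ℝ → ℝ) (s : ℝ) : ℂ := r s * exp (s * I)

theorem norm_polarPoint {r : ℝ → ℝ} (hr : ∀ s, 0 < r s) (s : ℝ) : ‖polarPoint r s‖ = r s := by
  rw [polarPoint, norm_mul, norm_exp_ofReal_mul_I, mul_one, norm_real,
    Real.norm_of_nonneg (hr s).le]

theorem ofReal_mul_exp_inj {a b s t : ℝ} (ha : 0 < a) (hb : 0 < b)
    (h : (a : ℂ) * exp (s * I) = b * exp (t * I)) : a = b ∧ ∃ n : ℤ, s = t + n * (2 * π) := by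
  have hab : a = b := by
    have := congrArg norm h
    simpa [norm_exp_ofReal_mul_I, abs_of_pos ha, abs_of_pos hb] using this
  refine ⟨hab, ?_⟩
  rw [hab, mul_right_inj' (by exact_mod_cast hb.ne'), Complex.exp_eq_exp_iff_exists_int] at h
  obtain ⟨n, hn⟩ := h
  refine ⟨n, ?_⟩
  have : (s : ℂ) * I = ((t + n * (2 * π) : ℝ) : ℂ) * I := by
    rw [hn]; push_cast; ring
  exact_mod_cast mul_right_cancel₀ I_ne_zero this

/-- `w` maps `q e^{it}` to `q r(ψ(t)) e^{iψ(t)}`, where `r` is a smooth positive periodic radius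
function and `ψ` is the lift of an orientation preserving homeomorphism of the circle. -/
structure IsRadialMap (r ψ : ℝ → ℝ) (w : ℂ → ℂ) : Prop where
  smooth : ContDiff ℝ 1 r
  periodic : Function.Periodic r (2 * π)
  pos : ∀ s, 0 < r s
  cont : Continuous ψ
  strictMono : StrictMono ψ
  surj : Function.Surjective ψ
  add_period : ∀ t, ψ (t + 2 * π) = ψ t + 2 * π
  apply_polar : ∀ q t : ℝ, 0 ≤ q → w (q * exp (t * I)) = q * polarPoint r (ψ t)

theorem add_int_mul_period {ψ : ℝ → ℝ} {c : ℝ} (h : ∀ t, ψ (t + c) = ψ t + c) (t : ℝ) (n : ℤ) :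
    ψ (t + n * c) = ψ t + n * c := by
  have hper : Function.Periodic (fun t => ψ t - t) c := fun t => by simp only [h t]; ring
  have : ψ (t + n * c) - (t + n * c) = ψ t - t := hper.int_mul n t
  linarith

theorem surjective_of_add_period {ψ : ℝ → ℝ} {c : ℝ} (hc : 0 < c) (hψ : Continuous ψ)
    (h : ∀ t, ψ (t + c) = ψ t + c) : Function.Surjective ψ := by
  intro s
  obtain ⟨n, hn⟩ := exists_int_gt ((s - ψ 0) / c)
  obtain ⟨m, hm⟩ := exists_int_lt ((s - ψ 0) / c)
  rw [div_lt_iff₀ hc] at hn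
  rw [lt_div_iff₀ hc] at hm
  have hn' := add_int_mul_period h 0 n
  have hm' := add_int_mul_period h 0 m
  exact mem_range_of_exists_le_of_exists_ge hψ ⟨0 + m * c, by linarith⟩ ⟨0 + n * c, by linarith⟩

theorem radius_eq_comp {γ : Set ℂ} {r : ℝ → ℝ} (hγ : IsSmoothStarlikeCurve γ r)
    (G : Circle ≃ₜ γ) {ρ ψ : ℝ → ℝ} (hρ : ∀ t, 0 < ρ t)
    (hG : ∀ t : ℝ, (G (Circle.exp t) : ℂ) = ρ t * Complex.exp (ψ t * Complex.I)) (t : ℝ) :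
    ρ t = r (ψ t) := by
  have hmem : (G (Circle.exp t) : ℂ) ∈ range fun s : ℝ => (r s : ℂ) * exp (s * I) :=
    hγ.curve_eq ▸ (G (Circle.exp t)).2
  rw [hG] at hmem
  obtain ⟨s, hs⟩ := hmem
  obtain ⟨h1, n, h2⟩ := ofReal_mul_exp_inj (hγ.pos s) (hρ t) hs
  rw [← h1, h2, hγ.periodic.int_mul n]

/-- The substance is that `ψ` has degree one. Over a period it gains `2πn` with `n ≥ 0`. If `n = 0`,
monotonicity makes `ψ` constant on the period; if `n ≥ 2`, the value `ψ t + 2π` is taken strictly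
inside it. Both contradict injectivity of `G`. -/
theorem isRadialMap_radialExtension {γ : Set ℂ} {r : ℝ → ℝ} (hγ : IsSmoothStarlikeCurve γ r)
    (G : Circle ≃ₜ γ) {ρ ψ : ℝ → ℝ} (hρ : ∀ t, 0 < ρ t) (hψ : Continuous ψ)
    (hG : ∀ t : ℝ, (G (Circle.exp t) : ℂ) = ρ t * Complex.exp (ψ t * Complex.I))
    (hor : Monotone ψ) : IsRadialMap r ψ (radialExtension fun u => (G u : ℂ)) := by
  have hρr := radius_eq_comp hγ G hρ hG
  have hpi : (0 : ℝ) < 2 * π := Real.two_pi_pos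
  have hinj : ∀ t t' : ℝ, ∀ n : ℤ, ψ t' = ψ t + n * (2 * π) → Circle.exp t' = Circle.exp t := by
    intro t t' n h
    refine G.injective (Subtype.ext ?_)
    rw [hG, hG, hρr, hρr, h, hγ.periodic.int_mul n]
    congr 1
    rw [Complex.exp_eq_exp_iff_exists_int]
    exact ⟨n, by push_cast; ring⟩
  have hne : ∀ t t' : ℝ, t < t' → t' < t + 2 * π → Circle.exp t' ≠ Circle.exp t := by
    intro t t' h1 h2 h
    rw [Circle.exp_eq_exp] at h
    obtain ⟨m, hm⟩ := h
    have h3 : (0 : ℝ) < m := by nlinarith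
    have h4 : (m : ℝ) < 1 := by nlinarith
    have h3' : (0 : ℤ) < m := by exact_mod_cast h3
    have h4' : m < 1 := by exact_mod_cast h4
    omega
  have hstep : ∀ t, ψ (t + 2 * π) = ψ t + 2 * π := by
    intro t
    have h1 := hG (t + 2 * π)
    have hexp : Circle.exp (t + 2 * π) = Circle.exp t :=
      Circle.exp_eq_exp.2 ⟨1, by push_cast; ring⟩
    rw [hexp, hG t] at h1
    obtain ⟨-, n, hn⟩ := ofReal_mul_exp_inj (hρ _) (hρ _) h1.symm
    have hmono : ψ t ≤ ψ (t + 2 * π) := hor (by linarith)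
    have hn0 : 0 ≤ n := by
      by_contra! hcon
      have : (n : ℝ) < 0 := by exact_mod_cast hcon
      nlinarith
    have hcase : n = 0 ∨ n = 1 ∨ 2 ≤ n := by omega
    rcases hcase with rfl | rfl | h2
    · exfalso
      refine hne t (t + π) (by linarith) (by linarith) (hinj t _ 0 ?_)
      have ha : ψ t ≤ ψ (t + π) := hor (by linarith)
      have hb : ψ (t + π) ≤ ψ (t + 2 * π) := hor (by linarith)
      simp only [Int.cast_zero, zero_mul, add_zero] at hn ⊢
      linarith
    · simpa using hn
    · exfalso
      have h2' : (2 : ℝ) ≤ n := by exact_mod_cast h2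
      obtain ⟨t', ⟨ht1, ht2⟩, ht'⟩ := intermediate_value_Icc (by linarith : t ≤ t + 2 * π)
        hψ.continuousOn (show ψ t + 2 * π ∈ Icc (ψ t) (ψ (t + 2 * π)) from
          ⟨by linarith, by nlinarith⟩)
      have hlt1 : t < t' := by
        refine lt_of_le_of_ne ht1 ?_
        rintro rfl; linarith
      have hlt2 : t' < t + 2 * π := by
        refine lt_of_le_of_ne ht2 ?_
        rintro rfl; nlinarith
      exact hne t t' hlt1 hlt2 (hinj t t' 1 (by simpa using ht'))
  refine ⟨hγ.smooth, hγ.periodic, hγ.pos, hψ, hor.strictMono_of_injective ?_,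
    surjective_of_add_period hpi hψ hstep, hstep, ?_⟩
  · intro t t' h
    have := hinj t' t 0 (by simpa using h)
    rw [Circle.exp_eq_exp] at this
    obtain ⟨m, hm⟩ := this
    have h2 := add_int_mul_period hstep t' m
    rw [← hm, h] at h2
    linarith
  · intro q t hq
    rcases hq.eq_or_lt with rfl | hq
    · simp [radialExtension]
    have hz : (q : ℂ) * exp (t * I) ≠ 0 :=
      mul_ne_zero (by exact_mod_cast hq.ne') (exp_ne_zero _)
    have hnorm : ‖(q : ℂ) * exp (t * I)‖ = q := by simp [norm_exp_ofReal_mul_I, abs_of_pos hq]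
    have hc : Circle.exp (arg ((q : ℂ) * exp (t * I))) = Circle.exp t := by
      apply Circle.ext
      rw [coe_circle_exp_arg hz, hnorm, mul_div_cancel_left₀ _ (by exact_mod_cast hq.ne'),
        Circle.coe_exp]
    rw [radialExtension, hc, hnorm, hG, hρr, polarPoint]

theorem exists_polar (z : ℂ) : ∃ t : ℝ, z = ‖z‖ * exp (t * I) :=
  ⟨arg z, (norm_mul_exp_arg_mul_I z).symm⟩

theorem polar_ne_zero {q : ℝ} (hq : 0 < q) (t : ℝ) : (q : ℂ) * exp (t * I) ≠ 0 :=
  mul_ne_zero (by exact_mod_cast hq.ne') (exp_ne_zero _)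

theorem norm_polar {q : ℝ} (hq : 0 ≤ q) (t : ℝ) : ‖(q : ℂ) * exp (t * I)‖ = q := by
  simp [norm_exp_ofReal_mul_I, abs_of_nonneg hq]

theorem continuous_polarPoint {r : ℝ → ℝ} (hr : Continuous r) : Continuous (polarPoint r) := by
  unfold polarPoint; fun_prop

namespace IsRadialMap

variable {r ψ : ℝ → ℝ} {w : ℂ → ℂ} (h : IsRadialMap r ψ w)
include h

theorem apply_zero : w 0 = 0 := by
  have := h.apply_polar 0 0 le_rfl
  simpa using this

theorem norm_apply_polar {q : ℝ} (hq : 0 ≤ q) (t : ℝ) : ‖w (q * exp (t * I))‖ = q * r (ψ t) := by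
  rw [h.apply_polar q t hq, norm_mul, norm_polarPoint h.pos, norm_real, Real.norm_of_nonneg hq]

/-- The map in logarithmic coordinates around `q e^{it}`. -/
theorem apply_polar_mul_exp {q : ℝ} (hq : 0 ≤ q) (t : ℝ) (ζ : ℂ) :
    w (q * exp (t * I) * exp ζ) = q * (Real.exp ζ.re * polarPoint r (ψ (t + ζ.im))) := by
  have : (q : ℂ) * exp (t * I) * exp ζ = (q * Real.exp ζ.re : ℝ) * exp ((t + ζ.im : ℝ) * I) := by
    push_cast
    rw [mul_assoc, mul_assoc, ← Complex.exp_add, ← Complex.exp_add]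
    congr 2
    nth_rewrite 1 [← re_add_im ζ]
    ring
  rw [this, h.apply_polar _ _ (by positivity)]
  push_cast; ring

/-- Dividing by the base point keeps the argument of `log` near 1 for nearby `z`, so the branch cut
of `arg` never interferes. -/
theorem apply_eq_log {q : ℝ} (hq : 0 < q) (t : ℝ) {z : ℂ} (hz : z ≠ 0) :
    w z = q * (Real.exp (log (z / (q * exp (t * I)))).re *
      polarPoint r (ψ (t + (log (z / (q * exp (t * I)))).im))) := by
  rw [← h.apply_polar_mul_exp hq.le, exp_log (div_ne_zero hz (polar_ne_zero hq t)),
    mul_div_cancel₀ _ (polar_ne_zero hq t)]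

theorem exists_radius_bounds : ∃ a b : ℝ, 0 < a ∧ ∀ s, a ≤ r s ∧ r s ≤ b := by
  have hc := h.periodic.compact_of_continuous Real.two_pi_pos.ne' h.smooth.continuous
  obtain ⟨_, ⟨s, rfl⟩, hs⟩ := hc.exists_isLeast (range_nonempty r)
  obtain ⟨_, ⟨s', rfl⟩, hs'⟩ := hc.exists_isGreatest (range_nonempty r)
  exact ⟨r s, r s', h.pos s, fun u => ⟨hs ⟨u, rfl⟩, hs' ⟨u, rfl⟩⟩⟩

theorem mul_norm_le_norm_apply {a : ℝ} (ha : ∀ s, a ≤ r s) (z : ℂ) : a * ‖z‖ ≤ ‖w z‖ := by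
  obtain ⟨t, ht⟩ := exists_polar z
  have := h.norm_apply_polar (norm_nonneg z) t
  rw [← ht] at this
  rw [this, mul_comm]
  exact mul_le_mul_of_nonneg_left (ha _) (norm_nonneg z)

theorem norm_apply_le {b : ℝ} (hb : ∀ s, r s ≤ b) (z : ℂ) : ‖w z‖ ≤ b * ‖z‖ := by
  obtain ⟨t, ht⟩ := exists_polar z
  have := h.norm_apply_polar (norm_nonneg z) t
  rw [← ht] at this
  rw [this, mul_comm]
  exact mul_le_mul_of_nonneg_right (hb _) (norm_nonneg z)

theorem continuous : Continuous w := by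
  obtain ⟨a, b, ha, hab⟩ := h.exists_radius_bounds
  refine continuous_iff_continuousAt.2 fun z => ?_
  rcases eq_or_ne z 0 with rfl | hz
  · rw [ContinuousAt, h.apply_zero]
    refine squeeze_zero_norm (h.norm_apply_le fun s => (hab s).2) ?_
    have : Continuous fun z : ℂ => b * ‖z‖ := by fun_prop
    simpa using this.tendsto 0
  · obtain ⟨t, ht⟩ := exists_polar z
    have hq : 0 < ‖z‖ := norm_pos_iff.2 hz
    have heq : w =ᶠ[𝓝 z] fun z' => ‖z‖ * (Real.exp (log (z' / z)).re *
        polarPoint r (ψ (t + (log (z' / z)).im))) := by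
      filter_upwards [isOpen_ne.mem_nhds hz] with z' hz'
      have := h.apply_eq_log hq t hz'
      rwa [← ht] at this
    refine ContinuousAt.congr ?_ heq.symm
    have h1 : ContinuousAt (fun z' => log (z' / z)) z := by
      refine ContinuousAt.clog (by fun_prop) ?_
      rw [div_self hz]; exact one_mem_slitPlane
    have h2 := continuous_polarPoint h.smooth.continuous
    have h3 := h.cont
    have h4 : Continuous fun ζ : ℂ => (‖z‖ : ℂ) * (Real.exp ζ.re *
        polarPoint r (ψ (t + ζ.im))) := by
      have : Continuous fun ζ : ℂ => polarPoint r (ψ (t + ζ.im)) :=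
        h2.comp (h3.comp (by fun_prop))
      fun_prop
    exact ContinuousAt.comp (g := fun ζ : ℂ => (‖z‖ : ℂ) * (Real.exp ζ.re *
        polarPoint r (ψ (t + ζ.im)))) h4.continuousAt h1

theorem injective : Function.Injective w := by
  intro z z' hzz
  obtain ⟨t, ht⟩ := exists_polar z
  obtain ⟨t', ht'⟩ := exists_polar z'
  have h1 := h.apply_polar _ t (norm_nonneg z)
  have h2 := h.apply_polar _ t' (norm_nonneg z')
  rw [← ht] at h1
  rw [← ht'] at h2
  have hn1 := h.norm_apply_polar (norm_nonneg z) t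
  have hn2 := h.norm_apply_polar (norm_nonneg z') t'
  rw [← ht] at hn1
  rw [← ht'] at hn2
  rcases eq_or_ne z 0 with rfl | hz
  · rw [← hzz, h.apply_zero, norm_zero] at hn2
    rcases mul_eq_zero.1 hn2.symm with h3 | h3
    · exact (norm_eq_zero.1 h3).symm
    · exact absurd h3 (h.pos _).ne'
  rcases eq_or_ne z' 0 with rfl | hz'
  · rw [hzz, h.apply_zero, norm_zero] at hn1
    rcases mul_eq_zero.1 hn1.symm with h3 | h3
    · exact (norm_eq_zero.1 h3)
    · exact absurd h3 (h.pos _).ne'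
  have hp := norm_pos_iff.2 hz
  have hp' := norm_pos_iff.2 hz'
  rw [h1, h2, polarPoint, polarPoint, ← mul_assoc, ← mul_assoc, ← ofReal_mul, ← ofReal_mul] at hzz
  obtain ⟨h3, n, h4⟩ := ofReal_mul_exp_inj (mul_pos hp (h.pos _)) (mul_pos hp' (h.pos _)) hzz
  rw [← add_int_mul_period h.add_period] at h4
  have h5 := h.strictMono.injective h4
  have h6 : ‖z‖ = ‖z'‖ := by
    rw [h4, add_int_mul_period h.add_period, h.periodic.int_mul n] at h3
    exact mul_right_cancel₀ (h.pos _).ne' h3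
  rw [ht, ht', h6, h5]
  congr 1
  rw [Complex.exp_eq_exp_iff_exists_int]
  exact ⟨n, by push_cast; ring⟩

theorem surjective : Function.Surjective w := by
  intro ζ
  obtain ⟨s, hs⟩ := exists_polar ζ
  obtain ⟨t, rfl⟩ := h.surj s
  refine ⟨(‖ζ‖ / r (ψ t) : ℝ) * exp (t * I), ?_⟩
  rw [h.apply_polar _ _ (div_nonneg (norm_nonneg _) (h.pos _).le), polarPoint, ← mul_assoc,
    ← ofReal_mul, div_mul_cancel₀ _ (h.pos _).ne', ← hs]

/-- The bound `a ‖z‖ ≤ ‖w z‖` makes `w` proper, hence closed. -/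
theorem isHomeomorph : IsHomeomorph w := by
  obtain ⟨a, b, ha, hab⟩ := h.exists_radius_bounds
  have hproper : IsProperMap w := by
    rw [isProperMap_iff_tendsto_cocompact]
    refine ⟨h.continuous, ?_⟩
    rw [← Metric.cobounded_eq_cocompact, ← tendsto_norm_atTop_iff_cobounded]
    refine tendsto_atTop_mono (h.mul_norm_le_norm_apply fun s => (hab s).1) ?_
    exact tendsto_norm_cobounded_atTop.const_mul_atTop ha
  exact isHomeomorph_iff_continuous_isClosedMap_bijective.2
    ⟨h.continuous, hproper.isClosedMap, h.injective, h.surjective⟩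

/-- A radial map as a homeomorphism of the plane. -/
def homeomorph : ℂ ≃ₜ ℂ := h.isHomeomorph.homeomorph w

theorem image_ball : w '' Metric.ball 0 1 = starlikeDomain r := by
  ext ζ
  constructor
  · rintro ⟨z, hz, rfl⟩
    obtain ⟨t, ht⟩ := exists_polar z
    have h1 := h.apply_polar _ t (norm_nonneg z)
    rw [← ht] at h1
    rw [mem_ball_zero_iff] at hz
    refine ⟨ψ t, ‖z‖ * r (ψ t), mul_nonneg (norm_nonneg _) (h.pos _).le, ?_, ?_⟩
    · have := h.pos (ψ t); nlinarith
    · rw [h1, polarPoint]; push_cast; ring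
  · rintro ⟨s, q, hq, hqr, rfl⟩
    obtain ⟨t, rfl⟩ := h.surj s
    have hr := h.pos (ψ t)
    refine ⟨(q / r (ψ t) : ℝ) * exp (t * I), ?_, ?_⟩
    · rw [mem_ball_zero_iff, norm_polar (div_nonneg hq hr.le), div_lt_one hr]; exact hqr
    · rw [h.apply_polar _ _ (div_nonneg hq hr.le), polarPoint, ← mul_assoc,
        ← ofReal_mul, div_mul_cancel₀ _ hr.ne']

theorem isHomeoOnto : IsHomeoOnto w (Metric.ball 0 1) (starlikeDomain r) :=
  ⟨h.homeomorph.toOpenPartialHomeomorphOfImageEq _ Metric.isOpen_ball _ h.image_ball,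
    rfl, rfl, fun _ _ => rfl⟩

end IsRadialMap

end Radial

/-! ### The matrix `(1, λc; 0, λ)`: norm and dilatation. -/

section Algebra

/-- The operator norm of `(1, Λ cot α; 0, Λ)`, where `σ = sin α`. -/
def stretchBound (σ Λ : ℝ) : ℝ :=
  (Real.sqrt (Λ ^ 2 + σ ^ 2 * (1 - 2 * Λ)) + Real.sqrt (Λ ^ 2 + σ ^ 2 * (1 + 2 * Λ))) / (2 * σ)

theorem stretch_numerator_nonneg {σ : ℝ} (hσ : 0 < σ) (hσ1 : σ ≤ 1) (Λ : ℝ) :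
    0 ≤ Λ ^ 2 + σ ^ 2 * (1 - 2 * Λ) := by
  have h : σ ^ 2 ≤ 1 := by nlinarith
  nlinarith [mul_nonneg (sq_nonneg Λ) (sub_nonneg.2 h), mul_nonneg (sq_nonneg σ) (sq_nonneg (Λ - 1))]

theorem stretch_denominator_pos {σ Λ : ℝ} (hσ : 0 < σ) (hΛ : 0 < Λ) :
    0 < Λ ^ 2 + σ ^ 2 * (1 + 2 * Λ) := by positivity

/-- For `A = (1, Λ cot α; 0, Λ)`, the matrix `AᵀA` has trace `1 + Λ²/σ²` and determinant `Λ²`. The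
square of `stretchBound` is the larger root of its characteristic polynomial; the product of the
roots is `Λ²`, so this root is at least `Λ`. -/
theorem stretchBound_sq {σ Λ : ℝ} (hσ : 0 < σ) (hσ1 : σ ≤ 1) (hΛ : 1 ≤ Λ) :
    Λ ≤ stretchBound σ Λ ^ 2 ∧ σ ^ 2 * (stretchBound σ Λ ^ 2) ^ 2 + σ ^ 2 * Λ ^ 2 =
      stretchBound σ Λ ^ 2 * (σ ^ 2 + Λ ^ 2) := by
  set P := Real.sqrt (Λ ^ 2 + σ ^ 2 * (1 - 2 * Λ)) with hP
  set Q := Real.sqrt (Λ ^ 2 + σ ^ 2 * (1 + 2 * Λ)) with hQ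
  have hP0 : 0 ≤ P := Real.sqrt_nonneg _
  have hQ0 : 0 ≤ Q := Real.sqrt_nonneg _
  have hP2 : P ^ 2 = Λ ^ 2 + σ ^ 2 * (1 - 2 * Λ) :=
    Real.sq_sqrt (stretch_numerator_nonneg hσ hσ1 Λ)
  have hQ2 : Q ^ 2 = Λ ^ 2 + σ ^ 2 * (1 + 2 * Λ) :=
    Real.sq_sqrt (stretch_denominator_pos hσ (by linarith)).le
  set X := stretchBound σ Λ ^ 2 with hX
  -- This is the quadratic formula: `P * Q` is the square root of the discriminant.
  have hXR : 2 * σ ^ 2 * X = Λ ^ 2 + σ ^ 2 + P * Q := by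
    have : X = (P + Q) ^ 2 / (2 * σ) ^ 2 := by rw [hX, stretchBound, div_pow]
    rw [this]
    field_simp
    nlinarith
  have hR2 : (P * Q) ^ 2 = (Λ ^ 2 + σ ^ 2) ^ 2 - 4 * Λ ^ 2 * σ ^ 4 := by
    rw [mul_pow, hP2, hQ2]; ring
  have hσ2 : 0 < σ ^ 2 := by positivity
  have hσ3 : σ ^ 2 ≤ 1 := by nlinarith
  constructor
  · have h1 : σ ^ 2 * Λ * 2 ≤ 2 * σ ^ 2 * X := by
      rw [hXR]
      nlinarith [mul_nonneg hP0 hQ0, mul_nonneg hσ2.le (sq_nonneg (Λ - 1)),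
        mul_nonneg (sq_nonneg Λ) (sub_nonneg.2 hσ3)]
    nlinarith
  · have h2 : (2 * σ ^ 2 * X - (Λ ^ 2 + σ ^ 2)) ^ 2 = (Λ ^ 2 + σ ^ 2) ^ 2 - 4 * Λ ^ 2 * σ ^ 4 := by
      rw [hXR, ← hR2]; ring
    have h3 : (4 * σ ^ 2) * (σ ^ 2 * X ^ 2 + σ ^ 2 * Λ ^ 2) = (4 * σ ^ 2) * (X * (σ ^ 2 + Λ ^ 2)) := by
      linarith
    exact mul_left_cancel₀ (by positivity) h3

/-- The form `X|v|² - |Av|²` in `v = (a, b)` is positive semidefinite: `X - 1` is its leading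
coefficient, and `hdet` says that its determinant is nonnegative. -/
theorem sq_add_sq_le_of_stretch {σ Λ X lam c : ℝ} (hσ : 0 < σ) (hΛ : 1 ≤ Λ)
    (hX : Λ ≤ X) (hX2 : σ ^ 2 * X ^ 2 + σ ^ 2 * Λ ^ 2 = X * (σ ^ 2 + Λ ^ 2))
    (hlam : 0 < lam) (hlam' : lam ≤ Λ) (hc : σ ^ 2 * (1 + c ^ 2) ≤ 1) (a b : ℝ) :
    (a + b * lam * c) ^ 2 + (b * lam) ^ 2 ≤ X * (a ^ 2 + b ^ 2) := by
  have hσ2 : 0 < σ ^ 2 := by positivity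
  have hσ3 : σ ^ 2 ≤ 1 := by nlinarith [mul_nonneg hσ2.le (sq_nonneg c)]
  have hA : 0 ≤ X - 1 := by linarith
  have hlam2 : lam ^ 2 ≤ Λ ^ 2 := by nlinarith
  have hdet : (lam * c) ^ 2 ≤ (X - 1) * (X - lam ^ 2 * (1 + c ^ 2)) := by
    have h1 : 0 ≤ σ ^ 2 * ((X - 1) * (X - lam ^ 2 * (1 + c ^ 2)) - (lam * c) ^ 2) := by
      have h2 : 0 ≤ (X - σ ^ 2) * (Λ ^ 2 - lam ^ 2) :=
        mul_nonneg (by linarith) (by linarith)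
      have h3 : 0 ≤ X * lam ^ 2 * (1 - σ ^ 2 * (1 + c ^ 2)) :=
        mul_nonneg (by nlinarith [sq_nonneg lam]) (by linarith)
      nlinarith
    have := nonneg_of_mul_nonneg_right h1 hσ2
    linarith
  -- If the leading coefficient vanishes, then `Λ = σ = 1` and `c = 0`, so the matrix is diagonal.
  rcases hA.eq_or_lt with h0 | hpos
  · have hX1 : X = 1 := by linarith
    have hΛ1 : Λ = 1 := by linarith
    have hs : σ ^ 2 = 1 := by rw [hX1, hΛ1] at hX2; linarith
    have hc0 : c = 0 := by
      rw [hs] at hc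
      have : c ^ 2 ≤ 0 := by linarith
      exact pow_eq_zero_iff two_ne_zero |>.1 (le_antisymm this (sq_nonneg c))
    rw [hX1, hc0]
    rw [hΛ1] at hlam2
    nlinarith [mul_nonneg (sq_nonneg b) (sub_nonneg.2 hlam2)]
  · have h1 : 0 ≤ (X - 1) * (X * (a ^ 2 + b ^ 2) - ((a + b * lam * c) ^ 2 + (b * lam) ^ 2)) := by
      nlinarith [sq_nonneg ((X - 1) * a - lam * c * b), mul_nonneg (sq_nonneg b) (sub_nonneg.2 hdet)]
    have := nonneg_of_mul_nonneg_right h1 hpos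
    linarith

/-- After clearing denominators, the difference is a nonnegative combination of `(Λ - lam)(lam Λ -
σ²)` and the slack in `hp`. The first is nonnegative because `lam Λ ≥ 1 ≥ σ²`. -/
theorem dilatation_le {σ Λ lam ρ p : ℝ} (hσ : 0 < σ) (hσ1 : σ ≤ 1) (hΛ : 1 ≤ Λ)
    (hlam : 1 / Λ ≤ lam) (hlam' : lam ≤ Λ) (hp : σ ^ 2 * (ρ ^ 2 + p ^ 2) ≤ ρ ^ 2) :
    ρ ^ 2 * (1 - lam) ^ 2 + lam ^ 2 * p ^ 2 ≤
      (Λ ^ 2 + σ ^ 2 * (1 - 2 * Λ)) / (Λ ^ 2 + σ ^ 2 * (1 + 2 * Λ)) *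
        (ρ ^ 2 * (1 + lam) ^ 2 + lam ^ 2 * p ^ 2) := by
  have hΛ0 : 0 < Λ := by linarith
  rw [div_mul_eq_mul_div, le_div_iff₀ (stretch_denominator_pos hσ hΛ0)]
  rw [div_le_iff₀ hΛ0] at hlam
  have hσ3 : σ ^ 2 ≤ 1 := by nlinarith
  have h1 : 0 ≤ (Λ - lam) * (lam * Λ - σ ^ 2) := mul_nonneg (by linarith) (by linarith)
  have h2 := mul_nonneg (sq_nonneg ρ) h1
  have h3 : 0 ≤ Λ * lam ^ 2 * (ρ ^ 2 - σ ^ 2 * (ρ ^ 2 + p ^ 2)) :=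
    mul_nonneg (by positivity) (by linarith)
  nlinarith

/-- Dropping the `p` terms bounds `lam`. For the angle, `h5` is quadratic in `lam`, and completing
the square eliminates `lam`. This gives the stronger ratio `(1 - k²)/(1 + k²)`, weakened at the end
by `1 + k² ≤ (1 + k)²`. -/
theorem bounds_of_dilatation {k lam ρ p : ℝ} (hk : 0 ≤ k) (hk1 : k < 1) (hlam : 0 ≤ lam)
    (hρ : 0 < ρ) (h : ρ ^ 2 * (1 - lam) ^ 2 + lam ^ 2 * p ^ 2 ≤
      k ^ 2 * (ρ ^ 2 * (1 + lam) ^ 2 + lam ^ 2 * p ^ 2)) :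
    (1 - k) / (1 + k) ≤ lam ∧ lam ≤ (1 + k) / (1 - k) ∧
      ((1 - k) / (1 + k)) ^ 2 * (ρ ^ 2 + p ^ 2) ≤ ρ ^ 2 := by
  have hk2 : 0 < 1 - k ^ 2 := by nlinarith
  have h1 : (ρ * (1 - lam)) ^ 2 ≤ (k * (ρ * (1 + lam))) ^ 2 := by
    nlinarith [mul_nonneg hk2.le (sq_nonneg (lam * p))]
  have h2 := abs_le_of_sq_le_sq' h1 (by positivity)
  have h3 : 1 - lam ≤ k * (1 + lam) := by nlinarith
  have h4 : -(k * (1 + lam)) ≤ 1 - lam := by nlinarith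
  refine ⟨by rw [div_le_iff₀ (by linarith)]; linarith, by rw [le_div_iff₀ (by linarith)]; linarith,
    ?_⟩
  rw [div_pow, div_mul_eq_mul_div, div_le_iff₀ (by positivity)]
  have h5 : (1 - k ^ 2) * (ρ ^ 2 + lam ^ 2 * (ρ ^ 2 + p ^ 2)) ≤ 2 * lam * (1 + k ^ 2) * ρ ^ 2 := by
    nlinarith
  set τ := ρ ^ 2 + p ^ 2 with hτ
  have hτ0 : 0 < τ := by positivity
  have h6 : (1 - k ^ 2) ^ 2 * τ ≤ (1 + k ^ 2) ^ 2 * ρ ^ 2 := by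
    have h7 := mul_le_mul_of_nonneg_left h5 (mul_nonneg hk2.le hτ0.le)
    have h8 := sq_nonneg ((1 - k ^ 2) * lam * τ - (1 + k ^ 2) * ρ ^ 2)
    have h9 : 0 ≤ ρ ^ 2 * ((1 + k ^ 2) ^ 2 * ρ ^ 2 - (1 - k ^ 2) ^ 2 * τ) := by nlinarith
    have := nonneg_of_mul_nonneg_right h9 (by positivity)
    linarith
  have h10 : (1 + k ^ 2) ^ 2 ≤ (1 + k) ^ 4 := by
    have : 1 + k ^ 2 ≤ (1 + k) ^ 2 := by nlinarith
    calc (1 + k ^ 2) ^ 2 ≤ ((1 + k) ^ 2) ^ 2 := by gcongr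
      _ = _ := by ring
  have h11 : (1 + k) ^ 2 * ((1 - k) ^ 2 * τ) ≤ (1 + k) ^ 2 * (ρ ^ 2 * (1 + k) ^ 2) := by
    nlinarith [mul_le_mul_of_nonneg_right h10 (sq_nonneg ρ)]
  exact le_of_mul_le_mul_left h11 (by positivity)

end Algebra

/-! ### The sine of the tangent angle. -/

section Angle

open scoped Real

theorem sin_tangentAngleAt {r : ℝ → ℝ} {s : ℝ} (hr : 0 < r s) :
    Real.sin (tangentAngleAt r s) = r s / Real.sqrt (r s ^ 2 + deriv r s ^ 2) := by
  have hpos : 0 < r s ^ 2 + deriv r s ^ 2 := by positivity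
  rw [tangentAngleAt, Real.sin_arccos, div_pow, Real.sq_sqrt hpos.le,
    one_sub_div hpos.ne', add_sub_cancel_right, Real.sqrt_div (sq_nonneg _), Real.sqrt_sq hr.le]

theorem continuous_tangentAngleAt {r : ℝ → ℝ} (hr : ContDiff ℝ 1 r) (hpos : ∀ s, 0 < r s) :
    Continuous (tangentAngleAt r) := by
  have h1 := hr.continuous
  have h2 := hr.continuous_deriv le_rfl
  refine Real.continuous_arccos.comp (h2.div (by fun_prop) fun s => ?_)
  have := hpos s
  positivity

theorem deriv_periodic {r : ℝ → ℝ} {c : ℝ} (h : Function.Periodic r c) :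
    Function.Periodic (deriv r) c := fun s => by
  rw [← deriv_comp_add_const]
  exact congrArg (fun f => deriv f s) (funext h)

/-- The sine of `α_γ` is the minimum of the sines of the angles `α_s`. -/
theorem sin_tangentAngle {r : ℝ → ℝ} (hr : ContDiff ℝ 1 r) (hpos : ∀ s, 0 < r s)
    (hper : Function.Periodic r (2 * π)) :
    (∀ s, Real.sin (tangentAngle r) ≤ Real.sin (tangentAngleAt r s)) ∧
      ∃ s, Real.sin (tangentAngle r) = Real.sin (tangentAngleAt r s) := by
  have hperiodic : Function.Periodic (tangentAngleAt r) (2 * π) := fun s => by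
    simp only [tangentAngleAt, hper s, deriv_periodic hper s]
  have hc := hperiodic.compact_of_continuous Real.two_pi_pos.ne' (continuous_tangentAngleAt hr hpos)
  obtain ⟨x, hx⟩ := hc.exists_isLeast (range_nonempty _)
  obtain ⟨y, hy⟩ := hc.exists_isGreatest (range_nonempty _)
  have hinf : (⨅ s, tangentAngleAt r s) = x := hx.csInf_eq
  have hsup : (⨆ s, tangentAngleAt r s) = y := hy.csSup_eq
  obtain ⟨⟨s₁, rfl⟩, hx⟩ := hx
  obtain ⟨⟨s₂, rfl⟩, hy⟩ := hy
  have h1 : tangentAngle r = min (tangentAngleAt r s₁) (π - tangentAngleAt r s₂) := by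
    rw [tangentAngle, hinf, hsup]
  have hnn : ∀ s, 0 ≤ tangentAngleAt r s ∧ tangentAngleAt r s ≤ π := fun s =>
    ⟨Real.arccos_nonneg _, Real.arccos_le_pi _⟩
  constructor
  · intro s
    have hle : tangentAngle r ≤ tangentAngleAt r s := by
      rw [h1]; exact (min_le_left _ _).trans (hx ⟨s, rfl⟩)
    have hle' : tangentAngle r ≤ π - tangentAngleAt r s := by
      rw [h1]; exact (min_le_right _ _).trans (sub_le_sub_left (hy ⟨s, rfl⟩) _)
    have h0 : 0 ≤ tangentAngle r := by
      rw [h1]; exact le_min (hnn _).1 (sub_nonneg.2 (hnn _).2)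
    rcases le_total (tangentAngleAt r s) (π / 2) with h2 | h2
    · exact Real.sin_le_sin_of_le_of_le_pi_div_two (by linarith [Real.pi_pos]) h2 hle
    · rw [← Real.sin_pi_sub (tangentAngleAt r s)]
      exact Real.sin_le_sin_of_le_of_le_pi_div_two (by linarith [Real.pi_pos]) (by linarith) hle'
  · rcases min_choice (tangentAngleAt r s₁) (π - tangentAngleAt r s₂) with h2 | h2
    · exact ⟨s₁, by rw [h1, h2]⟩
    · exact ⟨s₂, by rw [h1, h2, Real.sin_pi_sub]⟩

theorem sin_tangentAngle_pos {r : ℝ → ℝ} (hr : ContDiff ℝ 1 r) (hpos : ∀ s, 0 < r s)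
    (hper : Function.Periodic r (2 * π)) : 0 < Real.sin (tangentAngle r) := by
  obtain ⟨s, hs⟩ := (sin_tangentAngle hr hpos hper).2
  rw [hs, sin_tangentAngleAt (hpos s)]
  have := hpos s
  positivity

theorem sin_tangentAngle_sq_mul_le {r : ℝ → ℝ} (hr : ContDiff ℝ 1 r) (hpos : ∀ s, 0 < r s)
    (hper : Function.Periodic r (2 * π)) (s : ℝ) :
    Real.sin (tangentAngle r) ^ 2 * (r s ^ 2 + deriv r s ^ 2) ≤ r s ^ 2 := by
  have h1 := (sin_tangentAngle hr hpos hper).1 s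
  have h2 := sin_tangentAngle_pos hr hpos hper
  have h3 : 0 < r s ^ 2 + deriv r s ^ 2 := by have := hpos s; positivity
  rw [sin_tangentAngleAt (hpos s)] at h1
  have h4 := pow_le_pow_left₀ h2.le h1 2
  rwa [div_pow, Real.sq_sqrt h3.le, le_div_iff₀ h3] at h4

theorem le_sin_tangentAngle {r : ℝ → ℝ} (hr : ContDiff ℝ 1 r) (hpos : ∀ s, 0 < r s)
    (hper : Function.Periodic r (2 * π)) {κ : ℝ} (hκ : 0 ≤ κ)
    (h : ∀ s, κ ^ 2 * (r s ^ 2 + deriv r s ^ 2) ≤ r s ^ 2) : κ ≤ Real.sin (tangentAngle r) := by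
  obtain ⟨s, hs⟩ := (sin_tangentAngle hr hpos hper).2
  have h3 : 0 < r s ^ 2 + deriv r s ^ 2 := by have := hpos s; positivity
  rw [hs, sin_tangentAngleAt (hpos s)]
  refine (sq_le_sq₀ hκ (div_nonneg (hpos s).le (Real.sqrt_nonneg _))).1 ?_
  rw [div_pow, Real.sq_sqrt h3.le, le_div_iff₀ h3]
  exact h s

end Angle

/-! ### The formal derivative of a radial map. -/

section Derivative

open scoped Real

/-- The derivative of `polarPoint r`. -/
def polarTangent (r : ℝ → ℝ) (s : ℝ) : ℂ := (deriv r s + r s * I) * exp (s * I)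

theorem hasDerivAt_polarPoint {r : ℝ → ℝ} (hr : ContDiff ℝ 1 r) (s : ℝ) :
    HasDerivAt (polarPoint r) (polarTangent r s) s := by
  have h1 : HasDerivAt (fun s => (r s : ℂ)) ((deriv r s : ℝ) : ℂ) s :=
    ((hr.differentiable one_ne_zero) s).hasDerivAt.ofReal_comp
  have h2 : HasDerivAt (fun s : ℝ => exp (s * I)) (exp (s * I) * (1 * I)) s :=
    ((hasDerivAt_id s).ofReal_comp.mul_const I).cexp
  convert! h1.mul h2 using 1
  rw [polarTangent]; ring

/-- The formal derivative, in the direction `q e^{it} ζ`, of the radial map at `q e^{it}`, divided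
by `q`, where `s = ψ(t)` and `lam` stands for `ψ'(t)`. -/
def radialDeriv (r : ℝ → ℝ) (s lam : ℝ) (ζ : ℂ) : ℂ :=
  ζ.re * polarPoint r s + (ζ.im * lam : ℝ) * polarTangent r s

theorem norm_add_mul_I_mul_exp_sq (x y s : ℝ) :
    ‖((x : ℂ) + y * I) * exp (s * I)‖ ^ 2 = x ^ 2 + y ^ 2 := by
  rw [norm_mul, norm_exp_ofReal_mul_I, mul_one, Complex.sq_norm, normSq_add_mul_I]

theorem radialDeriv_eq (r : ℝ → ℝ) (s lam : ℝ) (ζ : ℂ) :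
    radialDeriv r s lam ζ = (((ζ.re * r s + ζ.im * lam * deriv r s : ℝ) : ℂ) +
      ((ζ.im * lam * r s : ℝ) : ℂ) * I) * exp (s * I) := by
  rw [radialDeriv, polarPoint, polarTangent]; push_cast; ring

theorem norm_radialDeriv_sq (r : ℝ → ℝ) (s lam : ℝ) (ζ : ℂ) :
    ‖radialDeriv r s lam ζ‖ ^ 2 =
      (ζ.re * r s + ζ.im * lam * deriv r s) ^ 2 + (ζ.im * lam * r s) ^ 2 := by
  rw [radialDeriv_eq, norm_add_mul_I_mul_exp_sq]

/-- With `r s` factored out, the matrix estimate applies with `c = r'/r`, the cotangent of the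
tangent angle. -/
theorem norm_radialDeriv_le {r : ℝ → ℝ} {s lam σ Λ : ℝ} (hr : 0 < r s) (hσ : 0 < σ) (hσ1 : σ ≤ 1)
    (hσr : σ ^ 2 * (r s ^ 2 + deriv r s ^ 2) ≤ r s ^ 2) (hΛ : 1 ≤ Λ) (hlam : 0 < lam)
    (hlam' : lam ≤ Λ) (ζ : ℂ) : ‖radialDeriv r s lam ζ‖ ≤ r s * stretchBound σ Λ * ‖ζ‖ := by
  obtain ⟨hX, hX2⟩ := stretchBound_sq hσ hσ1 hΛ
  have hN : 0 ≤ stretchBound σ Λ := by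
    rw [stretchBound]; positivity
  refine (sq_le_sq₀ (norm_nonneg _) (by positivity)).1 ?_
  have hc : σ ^ 2 * (1 + (deriv r s / r s) ^ 2) ≤ 1 := by
    rw [div_pow, one_add_div (by positivity), mul_div_assoc', div_le_one (by positivity)]
    exact hσr
  have := mul_le_mul_of_nonneg_left
    (sq_add_sq_le_of_stretch hσ hΛ hX hX2 hlam hlam' hc ζ.re ζ.im) (sq_nonneg (r s))
  rw [norm_radialDeriv_sq, mul_pow (r s * _), mul_pow (r s), Complex.sq_norm, normSq_apply]
  refine le_of_eq_of_le ?_ (this.trans_eq (by ring))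
  field_simp

/-- The vectors `ζ` and `I * ζ` span a square, and the determinant is `lam * r s ^ 2`; the area of
the image parallelogram is at most the product of its sides. This converts upper bounds into lower
bounds. -/
theorem mul_norm_sq_le_norm_radialDeriv (r : ℝ → ℝ) (s lam : ℝ) (ζ : ℂ) :
    lam * r s ^ 2 * ‖ζ‖ ^ 2 ≤ ‖radialDeriv r s lam ζ‖ * ‖radialDeriv r s lam (I * ζ)‖ := by
  refine le_of_abs_le (abs_le_of_sq_le_sq ?_ (by positivity))
  rw [mul_pow _ ‖radialDeriv r s lam (I * ζ)‖, norm_radialDeriv_sq, norm_radialDeriv_sq,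
    Complex.sq_norm, normSq_apply]
  simp only [mul_re, I_re, zero_mul, I_im, one_mul, zero_sub, mul_im, zero_add]
  set A := ζ.re * r s + ζ.im * lam * deriv r s
  set B := ζ.im * lam * r s
  set C := -ζ.im * r s + (ζ.re * lam) * deriv r s
  set D := (ζ.re * lam) * r s
  have h1 : lam * r s ^ 2 * (ζ.re * ζ.re + ζ.im * ζ.im) = A * D - B * C := by
    simp only [A, B, C, D]; ring
  have h2 : 0 + ζ.re = ζ.re := zero_add _
  rw [h1]
  nlinarith [sq_nonneg (A * C + B * D)]

end Derivative

/-! ### First-order expansion and bi-Lipschitz bounds for `w`. -/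

section LocalBounds

open Filter Topology
open scoped Real

/-- This smooth factor takes the increment of `ψ` as its variable, so expanding `w` requires no
derivative of `ψ`. -/
theorem hasFDerivAt_exp_mul_polarPoint {r : ℝ → ℝ} (hr : ContDiff ℝ 1 r) (s : ℝ) :
    ∃ A : ℂ →L[ℝ] ℂ, (∀ ω, A ω = ω.re * polarPoint r s + ω.im * polarTangent r s) ∧
      HasFDerivAt (fun ω : ℂ => (Real.exp ω.re : ℂ) * polarPoint r (s + ω.im)) A 0 := by
  have h1 : HasFDerivAt (fun ω : ℂ => ((Real.exp ω.re : ℝ) : ℂ))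
      (ofRealCLM.comp (Real.exp (0 : ℂ).re • reCLM)) 0 :=
    ofRealCLM.hasFDerivAt.comp (0 : ℂ) (g := fun x : ℝ => (x : ℂ))
      (f := fun ω : ℂ => Real.exp ω.re) (HasFDerivAt.exp (f := fun ω : ℂ => ω.re) reCLM.hasFDerivAt)
  have h0 : HasDerivAt (polarPoint r) (polarTangent r s) (s + (0 : ℂ).im) := by
    simpa using hasDerivAt_polarPoint hr s
  have h2 := h0.hasFDerivAt.comp (0 : ℂ) (imCLM.hasFDerivAt.const_add s)
  refine ⟨_, fun ω => ?_, h1.mul h2⟩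
  simp
  ring

theorem hasDerivAt_log_div {z : ℂ} (hz : z ≠ 0) :
    HasDerivAt (fun z' => log (z' / z)) (1 / z) z := by
  have h1 : HasDerivAt (fun z' : ℂ => z' / z) (1 / z) z := (hasDerivAt_id z).div_const z
  have := h1.clog (by rw [div_self hz]; exact one_mem_slitPlane)
  simpa [div_self hz] using this

namespace IsRadialMap

variable {r ψ : ℝ → ℝ} {w : ℂ → ℂ} (h : IsRadialMap r ψ w)
include h

theorem hasDerivAt_line {q : ℝ} (hq : 0 < q) {t lam : ℝ} (hψ : HasDerivAt ψ lam t) (v : ℂ) :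
    HasDerivAt (fun τ : ℝ => w (q * exp (t * I) + τ * v))
      (q * radialDeriv r (ψ t) lam (v / (q * exp (t * I)))) 0 := by
  set z := (q : ℂ) * exp (t * I) with hzdef
  have hz : z ≠ 0 := polar_ne_zero hq t
  have hline : HasDerivAt (fun τ : ℝ => z + τ * v) v 0 := by
    have := ((hasDerivAt_id (0 : ℝ)).ofReal_comp.mul_const v).const_add z
    simpa using this
  have hlog : HasDerivAt (fun τ : ℝ => log ((z + τ * v) / z)) (v / z) 0 := by
    have h1 : HasDerivAt (fun z' => log (z' / z)) (1 / z) (z + (0 : ℝ) * v) := by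
      simpa using hasDerivAt_log_div hz
    convert! h1.comp (0 : ℝ) hline using 1
    ring
  have hlog0 : log ((z + (0 : ℝ) * v) / z) = 0 := by simp [div_self hz]
  have hre : HasDerivAt (fun τ : ℝ => (log ((z + τ * v) / z)).re) (v / z).re 0 :=
    reCLM.hasFDerivAt.comp_hasDerivAt (0 : ℝ) hlog
  have him : HasDerivAt (fun τ : ℝ => (log ((z + τ * v) / z)).im) (v / z).im 0 :=
    imCLM.hasFDerivAt.comp_hasDerivAt (0 : ℝ) hlog
  have hψ' : HasDerivAt ψ lam (t + (log ((z + (0 : ℝ) * v) / z)).im) := by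
    rw [hlog0]; simpa using hψ
  have h1 := hψ'.comp (0 : ℝ) (him.const_add t)
  have hpp : HasDerivAt (polarPoint r) (polarTangent r (ψ t))
      ((ψ ∘ fun τ : ℝ => t + (log ((z + τ * v) / z)).im) 0) := by
    simp only [Function.comp_apply, hlog0, zero_im, add_zero]
    exact hasDerivAt_polarPoint h.smooth _
  have h2 := hpp.scomp (0 : ℝ) h1
  have h3 := (hre.exp.ofReal_comp.mul h2).const_mul (q : ℂ)
  have hev : ∀ᶠ τ : ℝ in 𝓝 0, z + τ * v ≠ 0 :=
    hline.continuousAt.eventually_ne (by simpa using hz)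
  convert! h3.congr_of_eventuallyEq (hev.mono fun τ hτ => h.apply_eq_log hq t hτ) using 1
  simp only [Function.comp_apply, hlog0, zero_im, zero_re, add_zero, Real.exp_zero, radialDeriv,
    real_smul]
  push_cast
  ring

/-- If `ψ` has difference quotients in `[1/L, L]`, the increments of `w` are, to first order,
given by the formal derivative with some parameter in `[1/L, L]`. -/
theorem eventually_exists_radialDeriv {L : ℝ} (hL : 1 ≤ L)
    (hψ : ∀ t t', t ≤ t' → 1 / L * (t' - t) ≤ ψ t' - ψ t ∧ ψ t' - ψ t ≤ L * (t' - t))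
    {q : ℝ} (hq : 0 < q) (t : ℝ) {ε : ℝ} (hε : 0 < ε) :
    ∀ᶠ z in 𝓝 ((q : ℂ) * exp (t * I)), ∃ lam : ℝ, ∃ ζ : ℂ, 1 / L ≤ lam ∧ lam ≤ L ∧
      ‖w z - w (q * exp (t * I)) - q * radialDeriv r (ψ t) lam ζ‖ ≤
        ε * ‖z - q * exp (t * I)‖ ∧
      |q * ‖ζ‖ - ‖z - q * exp (t * I)‖| ≤ ε * ‖z - q * exp (t * I)‖ := by
  have hL0 : 0 < L := by linarith
  set z₀ := (q : ℂ) * exp (t * I) with hz₀def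
  have hz₀ : z₀ ≠ 0 := polar_ne_zero hq t
  have hz₀n : ‖z₀‖ = q := norm_polar hq.le t
  obtain ⟨A, hA, hAd⟩ := hasFDerivAt_exp_mul_polarPoint h.smooth (ψ t)
  set ω : ℂ → ℂ := fun z => ((log (z / z₀)).re : ℂ) +
    ((ψ (t + (log (z / z₀)).im) - ψ t : ℝ) : ℂ) * I with hω
  have hlogc : ContinuousAt (fun z => log (z / z₀)) z₀ := (hasDerivAt_log_div hz₀).continuousAt
  have hωt : Tendsto ω (𝓝 z₀) (𝓝 0) := by
    have h1 : Continuous fun ζ : ℂ => ((ζ.re : ℝ) : ℂ) + ((ψ (t + ζ.im) - ψ t : ℝ) : ℂ) * I := by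
      have := h.cont
      fun_prop
    have h2 := h1.continuousAt.tendsto.comp hlogc.tendsto
    convert! h2 using 2
    simp [div_self hz₀]
  -- The denominator absorbs `‖ω z‖ ≤ (1 + L) ‖ζ‖` and `q ‖ζ‖ ≤ 2 ‖z - z₀‖`; the `1` in `min ε 1`
  -- below yields the latter.
  have hε₁ : 0 < ε / (2 * (1 + L)) := by positivity
  have e1 := hωt.eventually (hAd.isLittleO.def hε₁)
  have hε₂ : 0 < min ε 1 / q := by positivity
  have e2 := (hasDerivAt_log_div hz₀).isLittleO.def hε₂
  filter_upwards [e1, e2, isOpen_ne.mem_nhds hz₀] with z he1 he2 hz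
  set ζ := log (z / z₀) with hζ
  -- When `ζ.im = 0` the parameter has no effect; 1 is chosen because it lies in `[1/L, L]`.
  set lam : ℝ := if ζ.im = 0 then 1 else (ψ (t + ζ.im) - ψ t) / ζ.im with hlamdef
  have hmul : ζ.im * lam = ψ (t + ζ.im) - ψ t := by
    rw [hlamdef]
    split_ifs with h0
    · simp [h0]
    · field_simp
  have hlam : 1 / L ≤ lam ∧ lam ≤ L := by
    rcases lt_trichotomy ζ.im 0 with h0 | h0 | h0
    · obtain ⟨h1, h2⟩ := hψ (t + ζ.im) t (by linarith)
      constructor <;> nlinarith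
    · have : lam = 1 := by rw [hlamdef, if_pos h0]
      rw [this]
      exact ⟨by rw [div_le_one hL0]; exact hL, hL⟩
    · obtain ⟨h1, h2⟩ := hψ t (t + ζ.im) (by linarith)
      constructor <;> nlinarith
  have hlog1 : log (z₀ / z₀) = 0 := by simp [div_self hz₀]
  have hζn : |q * ‖ζ‖ - ‖z - z₀‖| ≤ min ε 1 * ‖z - z₀‖ := by
    rw [hlog1, sub_zero, smul_eq_mul, mul_one_div] at he2
    have h1 := abs_norm_sub_norm_le ζ ((z - z₀) / z₀)
    rw [norm_div, hz₀n] at h1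
    have h2 := mul_le_mul_of_nonneg_left (h1.trans he2) hq.le
    rw [← abs_of_pos hq, ← abs_mul, abs_of_pos hq, mul_sub, mul_div_cancel₀ _ hq.ne',
      ← mul_assoc, mul_div_cancel₀ _ hq.ne'] at h2
    exact h2
  refine ⟨lam, ζ, hlam.1, hlam.2, ?_,
    hζn.trans (mul_le_mul_of_nonneg_right (min_le_left _ _) (norm_nonneg _))⟩
  have hωre : (ω z).re = ζ.re := by simp [hω, hζ]
  have hωim : (ω z).im = ψ (t + ζ.im) - ψ t := by simp [hω, hζ]
  have hAω : A (ω z) = radialDeriv r (ψ t) lam ζ := by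
    rw [hA, hωre, hωim, radialDeriv, hmul]
  have hωn : ‖ω z‖ ≤ (1 + L) * ‖ζ‖ := by
    have h1 := norm_le_abs_re_add_abs_im (ω z)
    rw [hωre, hωim, ← hmul, abs_mul] at h1
    have h2 : |lam| ≤ L := abs_le.2 ⟨by have := one_div_pos.2 hL0; linarith [hlam.1], hlam.2⟩
    have h3 := abs_re_le_norm ζ
    have h4 := abs_im_le_norm ζ
    have h5 := mul_le_mul h4 h2 (abs_nonneg _) (norm_nonneg _)
    linarith
  rw [sub_zero, hAω, hωre, hωim] at he1
  have hw0 : w z₀ = q * polarPoint r (ψ t) := h.apply_polar q t hq.le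
  have hwz : w z = q * (Real.exp ζ.re * polarPoint r (ψ (t + ζ.im))) := h.apply_eq_log hq t hz
  have heq : w z - w z₀ - q * radialDeriv r (ψ t) lam ζ =
      q * ((Real.exp ζ.re : ℂ) * polarPoint r (ψ t + (ψ (t + ζ.im) - ψ t)) -
        (Real.exp (0 : ℂ).re : ℂ) * polarPoint r (ψ t + (0 : ℂ).im) -
        radialDeriv r (ψ t) lam ζ) := by
    rw [hw0, hwz, add_sub_cancel]
    simp
    ring
  rw [heq, norm_mul, norm_real, Real.norm_of_nonneg hq.le]
  have h6 : q * ‖ζ‖ ≤ 2 * ‖z - z₀‖ := by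
    have h7 := (le_abs_self _).trans hζn
    have h8 := mul_le_mul_of_nonneg_right (min_le_right ε 1) (norm_nonneg (z - z₀))
    linarith
  calc q * _ ≤ q * (ε / (2 * (1 + L)) * ((1 + L) * ‖ζ‖)) :=
        mul_le_mul_of_nonneg_left
          (he1.trans (mul_le_mul_of_nonneg_left hωn hε₁.le)) hq.le
    _ = ε / 2 * (q * ‖ζ‖) := by field_simp
    _ ≤ ε / 2 * (2 * ‖z - z₀‖) := mul_le_mul_of_nonneg_left h6 (by positivity)
    _ = ε * ‖z - z₀‖ := by ring

/-- Uniform bounds for the formal derivative are bi-Lipschitz bounds for `w`. -/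
theorem norm_sub_bounds {L l M : ℝ} (hL : 1 ≤ L)
    (hψ : ∀ t t', t ≤ t' → 1 / L * (t' - t) ≤ ψ t' - ψ t ∧ ψ t' - ψ t ≤ L * (t' - t))
    (hl : 0 < l) (hb : ∀ s lam : ℝ, ∀ ζ : ℂ, 1 / L ≤ lam → lam ≤ L →
      l * ‖ζ‖ ≤ ‖radialDeriv r s lam ζ‖ ∧ ‖radialDeriv r s lam ζ‖ ≤ M * ‖ζ‖) (x y : ℂ) :
    l * ‖y - x‖ ≤ ‖w y - w x‖ ∧ ‖w y - w x‖ ≤ M * ‖y - x‖ := by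
  have hL1 : 1 / L ≤ 1 := by rw [div_le_one (by linarith)]; exact hL
  -- Taking `lam = 1` and `ζ = 1` gives the radius itself, which settles the origin, where
  -- logarithmic coordinates fail.
  have hr : ∀ s, l ≤ r s ∧ r s ≤ M := by
    intro s
    have := hb s 1 1 hL1 hL
    simpa [radialDeriv, norm_polarPoint h.pos] using this
  have hM : 0 < M := hl.trans_le ((hr 0).1.trans (hr 0).2)
  have hloc : ∀ x : ℂ, ∀ ε > 0, ∀ᶠ y in 𝓝 x,
      (l - ε) * ‖y - x‖ ≤ ‖w y - w x‖ ∧ ‖w y - w x‖ ≤ (M + ε) * ‖y - x‖ := by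
    intro x ε hε
    rcases eq_or_ne x 0 with rfl | hx
    · refine Eventually.of_forall fun y => ?_
      rw [h.apply_zero, sub_zero, sub_zero]
      have h1 := h.mul_norm_le_norm_apply (fun s => (hr s).1) y
      have h2 := h.norm_apply_le (fun s => (hr s).2) y
      constructor <;> nlinarith [norm_nonneg y]
    · obtain ⟨t, ht⟩ := exists_polar x
      have hq : 0 < ‖x‖ := norm_pos_iff.2 hx
      -- The error is `δ D` from linearization plus `δ D M` from replacing `q ‖ζ‖` by `D`.
      have hδ : 0 < ε / (1 + M) := by positivity
      have hδM : ε / (1 + M) * (1 + M) = ε := by field_simp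
      have := h.eventually_exists_radialDeriv hL hψ hq t hδ
      rw [← ht] at this
      filter_upwards [this] with y ⟨lam, ζ, h1, h2, h3, h4⟩
      obtain ⟨h5, h6⟩ := hb (ψ t) lam ζ h1 h2
      set δ := ε / (1 + M)
      set D := ‖y - x‖
      have hD : 0 ≤ D := norm_nonneg _
      have h7 := abs_norm_sub_norm_le (w y - w x) (‖x‖ * radialDeriv r (ψ t) lam ζ)
      rw [norm_mul, norm_real, norm_norm] at h7
      have h8 := abs_le.1 (h7.trans h3)
      have h9 := abs_le.1 h4
      have h10 := mul_le_mul_of_nonneg_left h5 hq.le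
      have h11 := mul_le_mul_of_nonneg_left h6 hq.le
      have hlM : l ≤ M := (hr 0).1.trans (hr 0).2
      have h12 : δ * D * l ≤ δ * D * M := mul_le_mul_of_nonneg_left hlM (by positivity)
      have h13 : δ * D + δ * D * M = ε * D := by rw [← hδM]; ring
      constructor <;> nlinarith
  refine ⟨?_, norm_sub_le_of_eventually_norm_sub_le
    (fun x ε hε => (hloc x ε hε).mono fun _ hy => hy.2) x y⟩
  exact mul_norm_sub_le_of_eventually h.homeomorph hl
    (fun x ε hε => (hloc x ε hε).mono fun _ hy => hy.1) x y

end IsRadialMap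

end LocalBounds

/-! ### Wirtinger derivatives, orientation and quasiconformality. -/

section Quasiconformal

open Filter Topology
open scoped Real NNReal

theorem radialDeriv_ofReal_mul (r : ℝ → ℝ) (s lam q : ℝ) (ζ : ℂ) :
    q * radialDeriv r s lam ζ = radialDeriv r s lam (q * ζ) := by
  simp only [radialDeriv, re_ofReal_mul, im_ofReal_mul]
  push_cast
  ring

theorem exp_neg_ofReal_mul_I (t : ℝ) :
    exp (-(t * I)) = (Real.cos t : ℂ) - Real.sin t * I := by
  rw [← neg_mul, exp_mul_I, Complex.cos_neg, Complex.sin_neg, ofReal_cos, ofReal_sin]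
  ring

namespace IsRadialMap

variable {r ψ : ℝ → ℝ} {w : ℂ → ℂ} (h : IsRadialMap r ψ w)
include h

theorem partialX_eq {q : ℝ} (hq : 0 < q) {t lam : ℝ} (hψ : HasDerivAt ψ lam t) :
    partialX w (q * exp (t * I)) = Real.cos t * polarPoint r (ψ t) -
      (Real.sin t * lam : ℝ) * polarTangent r (ψ t) := by
  have h1 := h.hasDerivAt_line hq hψ 1
  simp only [mul_one] at h1
  rw [partialX, h1.deriv, radialDeriv_ofReal_mul]
  have : (q : ℂ) * (1 / (q * exp (t * I))) = (Real.cos t : ℂ) - Real.sin t * I := by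
    rw [← exp_neg_ofReal_mul_I, Complex.exp_neg]
    have : (q : ℂ) ≠ 0 := by exact_mod_cast hq.ne'
    field_simp
  rw [this, radialDeriv]
  simp only [sub_re, sub_im, ofReal_re, ofReal_im, re_ofReal_mul, im_ofReal_mul, I_re, I_im]
  push_cast
  ring

theorem partialY_eq {q : ℝ} (hq : 0 < q) {t lam : ℝ} (hψ : HasDerivAt ψ lam t) :
    partialY w (q * exp (t * I)) = Real.sin t * polarPoint r (ψ t) +
      (Real.cos t * lam : ℝ) * polarTangent r (ψ t) := by
  have h1 := h.hasDerivAt_line hq hψ I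
  rw [partialY, h1.deriv, radialDeriv_ofReal_mul]
  have : (q : ℂ) * (I / (q * exp (t * I))) = (Real.sin t : ℂ) + Real.cos t * I := by
    have h2 : (q : ℂ) * (I / (q * exp (t * I))) = I * exp (-(t * I)) := by
      rw [Complex.exp_neg]
      have : (q : ℂ) ≠ 0 := by exact_mod_cast hq.ne'
      field_simp
    rw [h2, exp_neg_ofReal_mul_I]
    linear_combination (-(Real.sin t : ℂ)) * I_sq
  rw [this, radialDeriv]
  simp only [add_re, add_im, ofReal_re, ofReal_im, re_ofReal_mul, im_ofReal_mul, I_re, I_im]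
  push_cast
  ring

/-- The derivatives carry the unimodular factors `e^{i(ψ(t) - t)}` and `e^{i(ψ(t) + t)}`, which the
norms discard. -/
theorem norm_wirtinger_sq {q : ℝ} (hq : 0 < q) {t lam : ℝ} (hψ : HasDerivAt ψ lam t) :
    4 * ‖wirtingerZ w (q * exp (t * I))‖ ^ 2 =
        r (ψ t) ^ 2 * (1 + lam) ^ 2 + lam ^ 2 * deriv r (ψ t) ^ 2 ∧
      4 * ‖wirtingerZbar w (q * exp (t * I))‖ ^ 2 =
        r (ψ t) ^ 2 * (1 - lam) ^ 2 + lam ^ 2 * deriv r (ψ t) ^ 2 := by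
  have hexp1 : exp ((ψ t - t : ℝ) * I) =
      exp (ψ t * I) * ((Real.cos t : ℂ) - Real.sin t * I) := by
    rw [← exp_neg_ofReal_mul_I, ← Complex.exp_add]; congr 1; push_cast; ring
  have hexp2 : exp ((ψ t + t : ℝ) * I) =
      exp (ψ t * I) * ((Real.cos t : ℂ) + Real.sin t * I) := by
    rw [ofReal_cos, ofReal_sin, ← exp_mul_I, ← Complex.exp_add]; congr 1; push_cast; ring
  constructor
  · have : wirtingerZ w (q * exp (t * I)) = (((r (ψ t) * (1 + lam) / 2 : ℝ) : ℂ) +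
        ((-(lam * deriv r (ψ t)) / 2 : ℝ) : ℂ) * I) * exp ((ψ t - t : ℝ) * I) := by
      rw [wirtingerZ, h.partialX_eq hq hψ, h.partialY_eq hq hψ, hexp1, polarPoint, polarTangent,
        Complex.div_I]
      push_cast
      linear_combination (exp (ψ t * I) * (r (ψ t) * lam * (-Complex.cos t) / 2 -
        (deriv r (ψ t) : ℝ) * lam * Complex.sin t / 2)) * I_sq
    rw [this, norm_add_mul_I_mul_exp_sq]
    ring
  · have : wirtingerZbar w (q * exp (t * I)) = (((r (ψ t) * (1 - lam) / 2 : ℝ) : ℂ) +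
        ((lam * deriv r (ψ t) / 2 : ℝ) : ℂ) * I) * exp ((ψ t + t : ℝ) * I) := by
      rw [wirtingerZbar, h.partialX_eq hq hψ, h.partialY_eq hq hψ, hexp2, polarPoint,
        polarTangent, Complex.div_I]
      push_cast
      linear_combination (exp (ψ t * I) * (r (ψ t) * lam * (Complex.cos t) / 2 -
        (deriv r (ψ t) : ℝ) * lam * Complex.sin t / 2)) * I_sq
    rw [this, norm_add_mul_I_mul_exp_sq]
    ring

/-- Moving the centre from 0 to `z` is a homotopy `H` that never vanishes, by injectivity. Its
argument lifts to `θ` on `ℝ × ℝ`. At the centre 0 the lift is `ψ`, which gains `2π` per turn, and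
uniqueness of lifts carries this gain to every centre. -/
theorem isSensePreserving (D : Set ℂ) : IsSensePreserving w D := by
  intro z R hR _
  set H : ℝ × ℝ → ℂ := fun p => w (p.1 * z + R * exp (p.2 * I)) - w (p.1 * z) with hH
  have hHc : Continuous H := by
    have := h.continuous
    fun_prop
  have hH0 : ∀ p, H p ≠ 0 := by
    intro p hp
    have := h.injective (sub_eq_zero.1 hp)
    exact polar_ne_zero hR p.2 (by simpa using this)
  have hu : ∀ p, H p / ‖H p‖ ∈ Submonoid.unitSphere ℂ := by
    intro p
    change _ ∈ Metric.sphere (0 : ℂ) 1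
    rw [mem_sphere_zero_iff_norm, norm_div, norm_real, norm_norm,
      div_self (norm_ne_zero_iff.2 (hH0 p))]
  set f : C(ℝ × ℝ, Circle) := ⟨fun p => ⟨H p / ‖H p‖, hu p⟩, by
    refine Continuous.subtype_mk (hHc.div (by fun_prop) fun p => ?_) _
    exact_mod_cast norm_ne_zero_iff.2 (hH0 p)⟩ with hf
  have hfv : ∀ p (θ : ℝ), Circle.exp θ = f p ↔ H p = ‖H p‖ * exp (θ * I) := by
    intro p θ
    have hn : (‖H p‖ : ℂ) ≠ 0 := by exact_mod_cast norm_ne_zero_iff.2 (hH0 p)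
    rw [Circle.ext_iff, Circle.coe_exp]
    change exp (θ * I) = H p / ‖H p‖ ↔ _
    rw [eq_div_iff hn, mul_comm, eq_comm]
  have hH_zero : ∀ t : ℝ, H (0, t) = (R * r (ψ t) : ℝ) * exp (ψ t * I) := by
    intro t
    simp only [hH, ofReal_zero, zero_mul, zero_add, h.apply_zero, sub_zero]
    rw [h.apply_polar R t hR.le, polarPoint]
    push_cast; ring
  have hf_zero : ∀ t : ℝ, Circle.exp (ψ t) = f (0, t) := by
    intro t
    rw [hfv, hH_zero, norm_polar (mul_pos hR (h.pos _)).le]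
  obtain ⟨θ, ⟨hθ0, hθ⟩, -⟩ := Circle.isCoveringMap_exp.existsUnique_continuousMap_lifts f (0, 0)
    (ψ 0) (hf_zero 0)
  have hθ' : ∀ p, Circle.exp (θ p) = f p := fun p => congrFun hθ p
  have hθψ : (fun t : ℝ => θ (0, t)) = ψ := by
    refine Circle.isCoveringMap_exp.eq_of_comp_eq (by fun_prop) h.cont ?_ 0 hθ0
    funext t
    simp only [Function.comp_apply, hθ', hf_zero]
  have hper : (fun p : ℝ × ℝ => θ (p.1, p.2 + 2 * π)) = fun p => θ p + 2 * π := by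
    refine Circle.isCoveringMap_exp.eq_of_comp_eq (by fun_prop) (by fun_prop) ?_ (0, 0) ?_
    · funext p
      have h1 : H (p.1, p.2 + 2 * π) = H p := by
        simp only [hH]
        have : exp ((p.2 + 2 * π : ℝ) * I) = exp (p.2 * I) := by
          rw [Complex.exp_eq_exp_iff_exists_int]
          exact ⟨1, by push_cast; ring⟩
        rw [this]
      have h2 : f (p.1, p.2 + 2 * π) = f p := by
        apply Circle.ext
        change H _ / ‖H _‖ = H _ / ‖H _‖
        rw [h1]
      simp only [Function.comp_apply, hθ', h2, Circle.exp_add]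
      rw [Circle.exp_two_pi, mul_one]
    · have h1 := congrFun hθψ (0 + 2 * π)
      change θ (0, 0 + 2 * π) = θ (0, 0) + 2 * π
      rw [hθ0, ← h.add_period 0]
      exact h1
  refine ⟨fun t => θ (1, t), by fun_prop, fun t => ?_, ?_⟩
  · have := (hfv (1, t) (θ (1, t))).1 (hθ' _)
    simpa [hH] using this
  · have := congrFun hper (1, 0)
    simp only [zero_add] at this
    simp only [this]; ring

end IsRadialMap

theorem isACL_comp_of_lipschitz {u : ℂ → ℝ} {K : ℝ≥0} (hu : LipschitzWith K u) (D : Set ℂ) :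
    IsACL u D := by
  intro a b c d _ _ _
  constructor
  · refine Eventually.of_forall fun y => ?_
    have h1 : LipschitzWith 1 fun x : ℝ => (x : ℂ) + y * I :=
      LipschitzWith.of_dist_le_mul fun x x' => by
        simp [dist_eq, Real.dist_eq, ← ofReal_sub]
    exact ((hu.comp h1).lipschitzOnWith (s := uIcc a b)).absolutelyContinuousOnInterval
  · refine Eventually.of_forall fun x => ?_
    have h1 : LipschitzWith 1 fun y : ℝ => (x : ℂ) + y * I :=
      LipschitzWith.of_dist_le_mul fun y y' => by
        simp [dist_eq, Real.dist_eq, ← sub_mul, ← ofReal_sub]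
    exact ((hu.comp h1).lipschitzOnWith (s := uIcc c d)).absolutelyContinuousOnInterval

namespace IsRadialMap

variable {r ψ : ℝ → ℝ} {w : ℂ → ℂ} (h : IsRadialMap r ψ w)
include h

theorem ae_polar_hasDerivAt {P : ℝ → Prop} (hP : ∀ᵐ t, P t) : ∀ᵐ z : ℂ, ∃ q t lam : ℝ,
    0 < q ∧ z = q * exp (t * I) ∧ HasDerivAt ψ lam t ∧ lam = deriv ψ t ∧ t = arg z ∧ P t := by
  have h0 : ∀ᵐ z : ℂ, z ≠ 0 := by simp [ae_iff]
  filter_upwards [h0, ae_arg_of_ae hP, ae_arg_of_ae h.strictMono.monotone.ae_differentiableAt]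
    with z hz hPz hd
  exact ⟨‖z‖, arg z, _, norm_pos_iff.2 hz, (norm_mul_exp_arg_mul_I z).symm, hd.hasDerivAt, rfl,
    rfl, hPz⟩

theorem isQuasiconformalWith {L σ M : ℝ} (hL : 1 ≤ L) (hσ : 0 < σ) (hσ1 : σ ≤ 1)
    (hσr : ∀ s, σ ^ 2 * (r s ^ 2 + deriv r s ^ 2) ≤ r s ^ 2)
    (hψ : ∀ᵐ t, 1 / L ≤ deriv ψ t ∧ deriv ψ t ≤ L)
    (hM : ∀ x y, ‖w y - w x‖ ≤ M * ‖y - x‖) :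
    IsQuasiconformalWith (Real.sqrt ((L ^ 2 + σ ^ 2 * (1 - 2 * L)) /
      (L ^ 2 + σ ^ 2 * (1 + 2 * L)))) w (Metric.ball 0 1) (starlikeDomain r) := by
  have hL0 : 0 < L := by linarith
  have hden := stretch_denominator_pos hσ hL0
  have hnum := stretch_numerator_nonneg hσ hσ1 L
  have hlip : LipschitzWith M.toNNReal w := LipschitzWith.of_dist_le_mul fun x y => by
    rw [dist_comm, dist_comm x, dist_eq_norm, dist_eq_norm]
    exact (hM x y).trans (mul_le_mul_of_nonneg_right (Real.le_coe_toNNReal M) (norm_nonneg _))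
  refine ⟨Real.sqrt_nonneg _, ?_, h.isHomeoOnto, h.isSensePreserving _, ?_, ?_, ?_⟩
  · rw [Real.sqrt_lt' one_pos, one_pow, div_lt_one hden]
    have : 0 < σ ^ 2 * L := by positivity
    nlinarith
  · exact isACL_comp_of_lipschitz (K := 1 * M.toNNReal)
      (LipschitzWith.comp (LipschitzWith.of_dist_le_mul fun x y => by
        simpa [dist_eq, Real.dist_eq] using abs_re_le_norm (x - y)) hlip) _
  · exact isACL_comp_of_lipschitz (K := 1 * M.toNNReal)
      (LipschitzWith.comp (LipschitzWith.of_dist_le_mul fun x y => by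
        simpa [dist_eq, Real.dist_eq] using abs_im_le_norm (x - y)) hlip) _
  · refine ae_restrict_of_ae ?_
    filter_upwards [h.ae_polar_hasDerivAt hψ] with z ⟨q, t, lam, hq, hz, hd, hlam, _, h1, h2⟩
    rw [← hlam] at h1 h2
    obtain ⟨h3, h4⟩ := h.norm_wirtinger_sq hq hd
    rw [← hz] at h3 h4
    have h5 := dilatation_le hσ hσ1 hL h1 h2 (hσr (ψ t))
    rw [← h3, ← h4] at h5
    refine (sq_le_sq₀ (norm_nonneg _) (by positivity)).1 ?_
    rw [mul_pow, Real.sq_sqrt (div_nonneg hnum hden.le)]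
    linarith

end IsRadialMap

end Quasiconformal

/-! ### From quasiconformality to `ψ`. -/

section Converse

open Filter Topology
open scoped Real NNReal

theorem ae_of_ae_restrict_Ioo_of_periodic {Q : ℝ → Prop} {a c : ℝ} (hc : 0 < c)
    (hQ : ∀ t (n : ℤ), Q t → Q (t + n * c)) (h : ∀ᵐ t ∂volume.restrict (Ioo a (a + c)), Q t) :
    ∀ᵐ t, Q t := by
  rw [ae_restrict_iff' measurableSet_Ioo] at h
  have h1 : ∀ᵐ t : ℝ, ∀ n : ℤ, t - n * c ∈ Ioo a (a + c) → Q (t - n * c) :=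
    ae_all_iff.2 fun n =>
      (measurePreserving_sub_right volume ((n : ℝ) * c)).quasiMeasurePreserving.ae h
  have h2 : ∀ᵐ t : ℝ, ∀ n : ℤ, t ≠ a + c + n * c :=
    ae_all_iff.2 fun n => by simp [ae_iff]
  filter_upwards [h1, h2] with t ht1 ht2
  have h3 := sub_toIocDiv_zsmul_mem_Ioc hc a t
  rw [zsmul_eq_mul] at h3
  have h4 := hQ _ (toIocDiv hc a t) (ht1 (toIocDiv hc a t)
    ⟨h3.1, lt_of_le_of_ne h3.2 fun h5 => ht2 (toIocDiv hc a t) (by linarith)⟩)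
  rwa [sub_add_cancel] at h4

/-- Written as `max (g y) c = c`, the inequality becomes an almost everywhere equality of continuous
functions, which holds everywhere. -/
theorem le_of_ae_le_of_continuous_Icc {g : ℝ → ℝ} {a b c : ℝ} (hab : a < b) (hg : Continuous g)
    (h : ∀ᵐ y ∂volume.restrict (Icc a b), g y ≤ c) {y : ℝ} (hy : y ∈ Icc a b) : g y ≤ c := by
  have h1 : (fun y => max (g y) c) =ᵐ[volume.restrict (Icc a b)] fun _ => c :=
    h.mono fun y hy => max_eq_right hy
  have h2 := Measure.eqOn_Icc_of_ae_eq volume hab.ne h1 (by fun_prop) (by fun_prop) hy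
  exact max_eq_right_iff.1 h2

/-- A continuous `ACL` function with bounded partial derivatives is Lipschitz on squares. -/
theorem IsACL.abs_sub_le {u : ℂ → ℝ} {D : Set ℂ} {a b C : ℝ} (hab : a < b) (hu : IsACL u D)
    (hc : Continuous u) (hD : Icc a b ×ℂ Icc a b ⊆ D)
    (hx : ∀ᵐ z : ℂ, |deriv (fun x : ℝ => u (x + z.im * I)) z.re| ≤ C)
    (hy : ∀ᵐ z : ℂ, |deriv (fun y : ℝ => u (z.re + y * I)) z.im| ≤ C)
    {z z' : ℂ} (hz : z ∈ Icc a b ×ℂ Icc a b) (hz' : z' ∈ Icc a b ×ℂ Icc a b) :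
    |u z' - u z| ≤ C * (|z'.re - z.re| + |z'.im - z.im|) := by
  obtain ⟨h1, h2⟩ := hu a b a b hab.le hab.le hD
  have hx' := (ae_ae_of_ae_complex hx).1
  have hy' := (ae_ae_of_ae_complex hy).2
  simp only [add_re, add_im, ofReal_re, ofReal_im, re_ofReal_mul, im_ofReal_mul, I_re, I_im,
    mul_zero, mul_one, add_zero, zero_add] at hx' hy'
  have hsub : ∀ {x₁ x₂ : ℝ}, x₁ ∈ Icc a b → x₂ ∈ Icc a b → x₁ ≤ x₂ → uIcc x₁ x₂ ⊆ uIcc a b := by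
    intro x₁ x₂ hx₁ hx₂ h
    rw [uIcc_of_le h, uIcc_of_le hab.le]
    exact Icc_subset_Icc hx₁.1 hx₂.2
  have hhor : ∀ x₁ ∈ Icc a b, ∀ x₂ ∈ Icc a b, x₁ ≤ x₂ → ∀ y ∈ Icc a b,
      |u (x₂ + y * I) - u (x₁ + y * I)| ≤ C * (x₂ - x₁) := by
    intro x₁ hx₁ x₂ hx₂ hle y hy
    refine le_of_ae_le_of_continuous_Icc hab (g := fun y : ℝ => |u (x₂ + y * I) - u (x₁ + y * I)|)
      (by fun_prop) ?_ hy
    filter_upwards [h1, ae_restrict_of_ae hx'] with y hy1 hy2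
    exact (hy1.mono (hsub hx₁ hx₂ hle)).abs_sub_le_of_ae hle (ae_restrict_of_ae hy2)
  have hver : ∀ y₁ ∈ Icc a b, ∀ y₂ ∈ Icc a b, y₁ ≤ y₂ → ∀ x ∈ Icc a b,
      |u (x + y₂ * I) - u (x + y₁ * I)| ≤ C * (y₂ - y₁) := by
    intro y₁ hy₁ y₂ hy₂ hle x hx
    refine le_of_ae_le_of_continuous_Icc hab
      (g := fun x : ℝ => |u (x + y₂ * I) - u (x + y₁ * I)|) (by fun_prop) ?_ hx
    filter_upwards [h2, ae_restrict_of_ae hy'] with x hx1 hx2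
    exact (hx1.mono (hsub hy₁ hy₂ hle)).abs_sub_le_of_ae hle (ae_restrict_of_ae hx2)
  -- The two points are joined through the corner `z'.re + z.im * I`, which stays in the square.
  have hh : |u (z'.re + z.im * I) - u (z.re + z.im * I)| ≤ C * |z'.re - z.re| := by
    rcases le_total z.re z'.re with h | h
    · rw [abs_of_nonneg (sub_nonneg.2 h)]
      exact hhor _ hz.1 _ hz'.1 h _ hz.2
    · rw [abs_sub_comm, abs_sub_comm z'.re, abs_of_nonneg (sub_nonneg.2 h)]
      exact hhor _ hz'.1 _ hz.1 h _ hz.2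
  have hv : |u (z'.re + z'.im * I) - u (z'.re + z.im * I)| ≤ C * |z'.im - z.im| := by
    rcases le_total z.im z'.im with h | h
    · rw [abs_of_nonneg (sub_nonneg.2 h)]
      exact hver _ hz.2 _ hz'.2 h _ hz'.1
    · rw [abs_sub_comm, abs_sub_comm z'.im, abs_of_nonneg (sub_nonneg.2 h)]
      exact hver _ hz'.2 _ hz.2 h _ hz'.1
  rw [re_add_im] at hh hv
  have := _root_.abs_sub_le (u z') (u (z'.re + z.im * I)) (u z)
  linarith

theorem norm_polarTangent_sq (r : ℝ → ℝ) (s : ℝ) :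
    ‖polarTangent r s‖ ^ 2 = r s ^ 2 + deriv r s ^ 2 := by
  rw [polarTangent, norm_add_mul_I_mul_exp_sq, add_comm]

theorem le_norm_polarTangent (r : ℝ → ℝ) (s : ℝ) : r s ≤ ‖polarTangent r s‖ := by
  refine le_of_abs_le (abs_le_of_sq_le_sq ?_ (norm_nonneg _))
  rw [norm_polarTangent_sq]
  nlinarith [sq_nonneg (deriv r s)]

theorem HasDerivAt.eventually_norm_sub {E : Type*} [NormedAddCommGroup E] [NormedSpace ℝ E]
    {f : ℝ → E} {f' : E} {x : ℝ} (hf : HasDerivAt f f' x) {a b : ℝ} (ha : a < ‖f'‖)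
    (hb : ‖f'‖ < b) :
    ∀ᶠ y in 𝓝 x, a * |y - x| ≤ ‖f y - f x‖ ∧ ‖f y - f x‖ ≤ b * |y - x| := by
  have hε : 0 < min (‖f'‖ - a) (b - ‖f'‖) := lt_min (sub_pos.2 ha) (sub_pos.2 hb)
  filter_upwards [hf.isLittleO.def hε] with y hy
  have h1 := (abs_norm_sub_norm_le (f y - f x) ((y - x) • f')).trans hy
  rw [norm_smul, Real.norm_eq_abs] at h1
  have h2 := abs_le.1 h1
  have h3 := mul_le_mul_of_nonneg_right (min_le_left (‖f'‖ - a) (b - ‖f'‖)) (abs_nonneg (y - x))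
  have h4 := mul_le_mul_of_nonneg_right (min_le_right (‖f'‖ - a) (b - ‖f'‖)) (abs_nonneg (y - x))
  constructor <;> linarith

theorem abs_deriv_re_im_le {f : ℝ → ℂ} {d : ℂ} {x C : ℝ} (hf : HasDerivAt f d x) (hd : ‖d‖ ≤ C) :
    |deriv (fun x => (f x).re) x| ≤ C ∧ |deriv (fun x => (f x).im) x| ≤ C := by
  have h1 : HasDerivAt (fun x => (f x).re) d.re x := reCLM.hasFDerivAt.comp_hasDerivAt x hf
  have h2 : HasDerivAt (fun x => (f x).im) d.im x := imCLM.hasFDerivAt.comp_hasDerivAt x hf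
  rw [h1.deriv, h2.deriv]
  exact ⟨(abs_re_le_norm d).trans hd, (abs_im_le_norm d).trans hd⟩

theorem norm_exp_sub_exp_le (t t' : ℝ) : ‖exp (t' * I) - exp (t * I)‖ ≤ |t' - t| := by
  have h1 : exp (t' * I) - exp (t * I) = exp (t * I) * (exp (I * (t' - t : ℝ)) - 1) := by
    rw [mul_sub, ← Complex.exp_add, mul_one]; congr 2; push_cast; ring
  rw [h1, norm_mul, norm_exp_ofReal_mul_I, one_mul]
  exact Real.norm_exp_I_mul_ofReal_sub_one_le

namespace IsRadialMap

variable {r ψ : ℝ → ℝ} {w : ℂ → ℂ} (h : IsRadialMap r ψ w)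
include h

theorem exists_tangent_bound : ∃ B : ℝ, 0 < B ∧ ∀ s, ‖polarTangent r s‖ < B := by
  obtain ⟨a, b, ha, hab⟩ := h.exists_radius_bounds
  have hσ := sin_tangentAngle_pos h.smooth h.pos h.periodic
  have hb : 0 < b := ha.trans_le ((hab 0).1.trans (hab 0).2)
  refine ⟨b / Real.sin (tangentAngle r) + 1, by positivity, fun s => ?_⟩
  suffices ‖polarTangent r s‖ ≤ b / Real.sin (tangentAngle r) by linarith
  rw [le_div_iff₀ hσ]
  refine (sq_le_sq₀ (by positivity) hb.le).1 ?_
  rw [mul_pow, norm_polarTangent_sq, mul_comm]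
  exact (sin_tangentAngle_sq_mul_le h.smooth h.pos h.periodic s).trans
    (pow_le_pow_left₀ (h.pos s).le (hab s).2 2)

/-- The tangent has length at least `a`, so `polarPoint r` locally stretches by at least `a / 2`;
the boundary bound thus passes to `ψ` locally, hence globally. -/
theorem abs_sub_le_of_boundary {C : ℝ}
    (hC : ∀ t t', ‖polarPoint r (ψ t') - polarPoint r (ψ t)‖ ≤ C * |t' - t|) :
    ∃ K : ℝ, ∀ t t', |ψ t' - ψ t| ≤ K * |t' - t| := by
  obtain ⟨a, b, ha, hab⟩ := h.exists_radius_bounds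
  refine ⟨2 * C / a, fun t t' => ?_⟩
  refine norm_sub_le_of_eventually_norm_sub_le (f := ψ) (fun t ε hε => ?_) t t'
  have hlow : a / 2 < ‖polarTangent r (ψ t)‖ := by
    have := (hab (ψ t)).1.trans (le_norm_polarTangent r (ψ t))
    linarith
  have h1 := (hasDerivAt_polarPoint h.smooth (ψ t)).eventually_norm_sub hlow (lt_add_one _)
  filter_upwards [(h.cont.tendsto t).eventually h1] with t' ht'
  have h2 := ht'.1.trans (hC t t')
  rw [Real.norm_eq_abs, Real.norm_eq_abs]
  have h3 : |ψ t' - ψ t| ≤ 2 * C / a * |t' - t| := by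
    rw [div_mul_eq_mul_div, le_div_iff₀ ha]
    linarith
  nlinarith [abs_nonneg (t' - t)]

theorem le_abs_sub_of_boundary {c : ℝ} (hc : 0 < c)
    (hC : ∀ t t' : ℝ, c * ‖exp (t' * I) - exp (t * I)‖ ≤
      ‖polarPoint r (ψ t') - polarPoint r (ψ t)‖) :
    ∃ K : ℝ, 0 < K ∧ ∀ t t', K * |t' - t| ≤ |ψ t' - ψ t| := by
  obtain ⟨B, hB, hBs⟩ := h.exists_tangent_bound
  let e : ℝ ≃ₜ ℝ := (h.strictMono.orderIsoOfSurjective ψ h.surj).toHomeomorph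
  have he : ∀ t, e t = ψ t := fun _ => rfl
  have hK : 0 < c / (2 * B) := by positivity
  refine ⟨c / (2 * B), hK, fun t t' => ?_⟩
  rw [← he, ← he, ← Real.norm_eq_abs, ← Real.norm_eq_abs]
  refine mul_norm_sub_le_of_eventually e hK (fun t ε hε => ?_) t t'
  have h1 := (hasDerivAt_polarPoint h.smooth (ψ t)).eventually_norm_sub (sub_one_lt _) (hBs (ψ t))
  have hexp : HasDerivAt (fun s : ℝ => exp (s * I)) (exp (t * I) * (1 * I)) t :=
    ((hasDerivAt_id t).ofReal_comp.mul_const I).cexp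
  have hn : ‖exp (t * I) * (1 * I)‖ = 1 := by simp [norm_exp_ofReal_mul_I]
  -- Near `t` a chord of the unit circle is at least half its arc, whence the 2 in `c / (2 * B)`.
  have h2 := hexp.eventually_norm_sub (a := 1 / 2) (b := 2) (by rw [hn]; norm_num)
    (by rw [hn]; norm_num)
  filter_upwards [(h.cont.tendsto t).eventually h1, h2] with t' h3 h4
  have h5 := (hC t t').trans h3.2
  have h6 := mul_le_mul_of_nonneg_left h4.1 hc.le
  rw [he, he, Real.norm_eq_abs, Real.norm_eq_abs]
  have h7 : c / (2 * B) * |t' - t| ≤ |ψ t' - ψ t| := by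
    rw [div_mul_eq_mul_div, div_le_iff₀ (by positivity)]
    linarith
  nlinarith [abs_nonneg (t' - t)]

theorem deriv_periodic_add (t : ℝ) (n : ℤ) : deriv ψ (t + n * (2 * π)) = deriv ψ t := by
  have h1 : Function.Periodic (deriv ψ) (2 * π) := fun s => by
    rw [← deriv_comp_add_const]
    simp only [h.add_period, deriv_add_const]
  exact h1.int_mul n t

theorem ae_deriv_bounds {k : ℝ}
    (hw : IsQuasiconformalWith k w (Metric.ball 0 1) (starlikeDomain r)) :
    ∀ᵐ t, (1 - k) / (1 + k) ≤ deriv ψ t ∧ deriv ψ t ≤ (1 + k) / (1 - k) ∧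
      ((1 - k) / (1 + k)) ^ 2 * (r (ψ t) ^ 2 + deriv r (ψ t) ^ 2) ≤ r (ψ t) ^ 2 := by
  refine ae_of_ae_restrict_Ioo_of_periodic (a := -π) Real.two_pi_pos (fun t n ht => ?_) ?_
  · rwa [h.deriv_periodic_add, add_int_mul_period h.add_period, h.periodic.int_mul n,
      (deriv_periodic h.periodic).int_mul n]
  · rw [show -π + 2 * π = π by ring]
    refine ae_of_ae_arg ?_
    filter_upwards [hw.dilatation, ae_restrict_of_ae (h.ae_polar_hasDerivAt (P := fun _ => True)
      (Eventually.of_forall fun _ => trivial))] with z hz ⟨q, t, lam, hq, hzq, hd, hlam, harg, _⟩ _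
    obtain ⟨h3, h4⟩ := h.norm_wirtinger_sq hq hd
    rw [← hzq] at h3 h4
    have hlam0 : 0 ≤ lam := by rw [hlam]; exact h.strictMono.monotone.deriv_nonneg
    rw [← harg, ← hlam]
    refine bounds_of_dilatation hw.nonneg hw.lt_one hlam0 (h.pos _) ?_
    rw [← h3, ← h4]
    have := pow_le_pow_left₀ (norm_nonneg _) hz 2
    rw [mul_pow] at this
    linarith

theorem le_sin_of_quasiconformal {k : ℝ}
    (hw : IsQuasiconformalWith k w (Metric.ball 0 1) (starlikeDomain r)) :
    (1 - k) / (1 + k) ≤ Real.sin (tangentAngle r) := by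
  have hk := hw.nonneg
  have hk1 := hw.lt_one
  refine le_sin_tangentAngle h.smooth h.pos h.periodic
    (div_nonneg (by linarith) (by linarith)) fun s => ?_
  obtain ⟨t, rfl⟩ := h.surj s
  have h1 : (fun t => max (((1 - k) / (1 + k)) ^ 2 * (r (ψ t) ^ 2 + deriv r (ψ t) ^ 2))
      (r (ψ t) ^ 2)) =ᵐ[volume] fun t => r (ψ t) ^ 2 :=
    (h.ae_deriv_bounds hw).mono fun t ht => max_eq_right ht.2.2
  have hr := h.smooth.continuous
  have hr' := h.smooth.continuous_deriv le_rfl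
  have hψ := h.cont
  have h2 := Measure.eq_of_ae_eq h1 (by fun_prop) (by fun_prop)
  exact max_eq_right_iff.1 (congrFun h2 t)

/-- A crude constant suffices: it only serves to make `w` Lipschitz on a square. -/
theorem exists_ae_deriv_line_le {k : ℝ}
    (hw : IsQuasiconformalWith k w (Metric.ball 0 1) (starlikeDomain r)) :
    ∃ C : ℝ, 0 ≤ C ∧ ∀ v : ℂ, ‖v‖ = 1 → ∀ᵐ z : ℂ, ∃ d : ℂ, ‖d‖ ≤ C ∧
      HasDerivAt (fun τ : ℝ => w (z + τ * v)) d 0 := by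
  obtain ⟨a, b, ha, hab⟩ := h.exists_radius_bounds
  obtain ⟨B, hB, hBs⟩ := h.exists_tangent_bound
  have hk := hw.nonneg
  have hk1 := hw.lt_one
  have hb : 0 < b := ha.trans_le ((hab 0).1.trans (hab 0).2)
  have hK : 0 ≤ (1 + k) / (1 - k) := div_nonneg (by linarith) (by linarith)
  refine ⟨b + (1 + k) / (1 - k) * B, by positivity, fun v hv => ?_⟩
  filter_upwards [h.ae_polar_hasDerivAt (h.ae_deriv_bounds hw)] with z
    ⟨q, t, lam, hq, hzq, hd, hlam, _, h1, h2, _⟩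
  refine ⟨_, ?_, by rw [hzq]; exact h.hasDerivAt_line hq hd v⟩
  rw [← hlam] at h1 h2
  have hlam0 : 0 ≤ lam := by rw [hlam]; exact h.strictMono.monotone.deriv_nonneg
  rw [radialDeriv_ofReal_mul]
  set ζ := (q : ℂ) * (v / (q * exp (t * I)))
  have hζ : ‖ζ‖ = 1 := by
    rw [norm_mul, norm_div, norm_polar hq.le, norm_real, Real.norm_of_nonneg hq.le, hv]
    field_simp
  have h3 := abs_re_le_norm ζ
  have h4 := abs_im_le_norm ζ
  rw [hζ] at h3 h4
  rw [radialDeriv]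
  refine (norm_add_le _ _).trans ?_
  rw [norm_mul, norm_mul, norm_real, norm_real, norm_polarPoint h.pos, Real.norm_eq_abs,
    Real.norm_eq_abs, abs_mul, abs_of_nonneg hlam0]
  have h5 : |ζ.re| * r (ψ t) ≤ 1 * b :=
    mul_le_mul h3 (hab _).2 (h.pos _).le zero_le_one
  have h6 : |ζ.im| * lam ≤ 1 * ((1 + k) / (1 - k)) := mul_le_mul h4 h2 hlam0 zero_le_one
  have h7 := mul_le_mul h6 (hBs (ψ t)).le (norm_nonneg _) (by linarith)
  linarith

theorem exists_boundary_lipschitz {k : ℝ}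
    (hw : IsQuasiconformalWith k w (Metric.ball 0 1) (starlikeDomain r)) :
    ∃ C : ℝ, ∀ t t', ‖polarPoint r (ψ t') - polarPoint r (ψ t)‖ ≤ C * |t' - t| := by
  obtain ⟨C, hC0, hC⟩ := h.exists_ae_deriv_line_le hw
  have hx : ∀ᵐ z : ℂ, ∃ d : ℂ, ‖d‖ ≤ C ∧
      HasDerivAt (fun x : ℝ => w (x + z.im * I)) d z.re := by
    filter_upwards [hC 1 norm_one] with z ⟨d, hd, hdd⟩
    refine ⟨d, hd, ?_⟩
    have h1 : HasDerivAt (fun τ : ℝ => w (z + τ * 1)) d (z.re - z.re) := by rwa [sub_self]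
    have h2 := h1.comp_sub_const z.re z.re
    convert! h2 using 2 with x
    congr 1
    nth_rewrite 2 [← re_add_im z]
    push_cast; ring
  have hy : ∀ᵐ z : ℂ, ∃ d : ℂ, ‖d‖ ≤ C ∧
      HasDerivAt (fun y : ℝ => w (z.re + y * I)) d z.im := by
    filter_upwards [hC I norm_I] with z ⟨d, hd, hdd⟩
    refine ⟨d, hd, ?_⟩
    have h1 : HasDerivAt (fun τ : ℝ => w (z + τ * I)) d (z.im - z.im) := by rwa [sub_self]
    have h2 := h1.comp_sub_const z.im z.im
    convert! h2 using 2 with y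
    congr 1
    nth_rewrite 2 [← re_add_im z]
    push_cast; ring
  have hsq : Icc (-(1 / 2) : ℝ) (1 / 2) ×ℂ Icc (-(1 / 2) : ℝ) (1 / 2) ⊆ Metric.ball 0 1 := by
    rintro z ⟨⟨h1, h2⟩, ⟨h3, h4⟩⟩
    rw [mem_ball_zero_iff, ← sq_lt_one_iff₀ (norm_nonneg _), Complex.sq_norm, normSq_apply]
    nlinarith
  have hmem : ∀ t : ℝ, ((1 / 2 : ℝ) : ℂ) * exp (t * I) ∈
      Icc (-(1 / 2) : ℝ) (1 / 2) ×ℂ Icc (-(1 / 2) : ℝ) (1 / 2) := by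
    intro t
    have h0 := norm_polar (q := 1 / 2) (by norm_num) t
    have h1 := abs_re_le_norm (((1 / 2 : ℝ) : ℂ) * exp (t * I))
    have h2 := abs_im_le_norm (((1 / 2 : ℝ) : ℂ) * exp (t * I))
    rw [h0] at h1 h2
    exact ⟨abs_le.1 h1, abs_le.1 h2⟩
  have hwc := h.continuous
  have hre := fun t t' => hw.acl_re.abs_sub_le (C := C) (by norm_num) (by fun_prop) hsq
    (hx.mono fun z ⟨d, hd, hdd⟩ => (abs_deriv_re_im_le hdd hd).1)
    (hy.mono fun z ⟨d, hd, hdd⟩ => (abs_deriv_re_im_le hdd hd).1) (hmem t) (hmem t')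
  have him := fun t t' => hw.acl_im.abs_sub_le (C := C) (by norm_num) (by fun_prop) hsq
    (hx.mono fun z ⟨d, hd, hdd⟩ => (abs_deriv_re_im_le hdd hd).2)
    (hy.mono fun z ⟨d, hd, hdd⟩ => (abs_deriv_re_im_le hdd hd).2) (hmem t) (hmem t')
  -- Real and imaginary parts contribute `C |t' - t|` each, and passing from radius 1/2 to the
  -- boundary doubles the sum.
  refine ⟨4 * C, fun t t' => ?_⟩
  have h1 := hre t t'
  have h2 := him t t'
  set z := ((1 / 2 : ℝ) : ℂ) * exp (t * I) with hz
  set z' := ((1 / 2 : ℝ) : ℂ) * exp (t' * I) with hz'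
  have h3 := norm_le_abs_re_add_abs_im (w z' - w z)
  rw [sub_re, sub_im] at h3
  have h4 := abs_re_le_norm (z' - z)
  have h5 := abs_im_le_norm (z' - z)
  rw [sub_re] at h4
  rw [sub_im] at h5
  have h6 : ‖z' - z‖ ≤ 1 / 2 * |t' - t| := by
    rw [hz, hz', ← mul_sub, norm_mul, norm_real, Real.norm_of_nonneg (by norm_num)]
    refine mul_le_mul_of_nonneg_left ?_ (by norm_num)
    exact norm_exp_sub_exp_le t t'
  have h8 : w z' - w z = ((1 / 2 : ℝ) : ℂ) * (polarPoint r (ψ t') - polarPoint r (ψ t)) := by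
    rw [hz, hz', h.apply_polar _ _ (by norm_num), h.apply_polar _ _ (by norm_num), mul_sub]
  rw [h8, norm_mul, norm_real, Real.norm_of_nonneg (by norm_num)] at h3
  have h9 : C * (|z'.re - z.re| + |z'.im - z.im|) ≤ C * |t' - t| :=
    mul_le_mul_of_nonneg_left (by linarith) hC0
  linarith

end IsRadialMap

end Converse

/-! ### Essential bounds on `ψ'` and the equivalences. -/

section Main

open Filter Topology
open scoped Real NNReal ENNReal

/-- The bound `C` makes the essential supremum finite; otherwise `toReal` would return 0. -/
theorem ae_abs_le_linftyNorm {f : ℝ → ℝ} {C : ℝ} (hf : ∀ᵐ t, |f t| ≤ C) :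
    ∀ᵐ t, |f t| ≤ linftyNorm f := by
  have hfin : eLpNorm f ⊤ volume < ⊤ := by
    rw [eLpNorm_exponent_top]
    exact eLpNormEssSup_lt_top_of_ae_bound hf
  filter_upwards [enorm_ae_le_eLpNormEssSup f volume] with t ht
  rw [← eLpNorm_exponent_top] at ht
  have := ENNReal.toReal_mono hfin.ne ht
  rwa [toReal_enorm, Real.norm_eq_abs] at this

theorem IsBiLipschitz.exists_slope_bounds {ψ : ℝ → ℝ} (hψ : Monotone ψ) (h : IsBiLipschitz ψ) :
    ∃ l M : ℝ, 0 < l ∧ 0 < M ∧ (∀ t, |deriv ψ t| ≤ M) ∧ (∀ᵐ t, l ≤ deriv ψ t) ∧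
      LipschitzWith M.toNNReal ψ := by
  obtain ⟨l, M, hl, hlM, hb⟩ := h
  have hM : 0 < M := hl.trans_le hlM
  have hlip : LipschitzWith M.toNNReal ψ := LipschitzWith.of_dist_le_mul fun x y => by
    rw [Real.coe_toNNReal _ hM.le]; exact (hb x y).2
  refine ⟨l, M, hl, hM, fun t => ?_, ?_, hlip⟩
  · have := norm_deriv_le_of_lipschitz hlip (x₀ := t)
    rwa [Real.coe_toNNReal _ hM.le, Real.norm_eq_abs] at this
  · filter_upwards [hψ.ae_differentiableAt] with t ht
    have hmono : Monotone fun s => ψ s - l * s := by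
      intro s s' hs
      have h1 := (hb s s').1
      rw [Real.dist_eq, Real.dist_eq, abs_sub_comm, abs_sub_comm (ψ s),
        abs_of_nonneg (sub_nonneg.2 hs), abs_of_nonneg (sub_nonneg.2 (hψ hs))] at h1
      simp only
      linarith
    have h2 := hmono.deriv_nonneg (x := t)
    have h3 : HasDerivAt (fun s => ψ s - l * s) (deriv ψ t - l) t := by
      simpa using! ht.hasDerivAt.sub ((hasDerivAt_id t).const_mul l)
    rw [h3.deriv] at h2
    linarith

theorem isBiLipschitzWith_of_slopes {ψ : ℝ → ℝ} {l M : ℝ} (hl : 0 < l)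
    (h : ∀ t t', t ≤ t' → l * (t' - t) ≤ ψ t' - ψ t ∧ ψ t' - ψ t ≤ M * (t' - t)) :
    IsBiLipschitzWith l M ψ := by
  refine ⟨hl, ?_, ?_⟩
  · have := h 0 1 zero_le_one
    linarith [this.1, this.2]
  · have key : ∀ t t', t ≤ t' → l * dist t t' ≤ dist (ψ t) (ψ t') ∧
        dist (ψ t) (ψ t') ≤ M * dist t t' := by
      intro t t' htt
      obtain ⟨h1, h2⟩ := h t t' htt
      have h3 : 0 ≤ t' - t := sub_nonneg.2 htt
      have h4 : 0 ≤ ψ t' - ψ t := (mul_nonneg hl.le h3).trans h1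
      rw [dist_comm, dist_comm (ψ t), Real.dist_eq, Real.dist_eq, abs_of_nonneg h3,
        abs_of_nonneg h4]
      exact ⟨h1, h2⟩
    intro t t'
    rcases le_total t t' with htt | htt
    · exact key t t' htt
    · rw [dist_comm, dist_comm (ψ t)]
      exact key t' t htt

/-- The consequences of `ψ` being bi-Lipschitz for the constant `L`. -/
theorem IsBiLipschitz.deriv_bounds {ψ : ℝ → ℝ} (hψ : Monotone ψ) (h : IsBiLipschitz ψ) {L : ℝ}
    (hL : L = max (linftyNorm (deriv ψ)) (linftyNorm (fun t => 1 / deriv ψ t))) :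
    1 ≤ L ∧ (∀ᵐ t, 1 / L ≤ deriv ψ t ∧ deriv ψ t ≤ L) ∧
      ∀ t t', t ≤ t' → 1 / L * (t' - t) ≤ ψ t' - ψ t ∧ ψ t' - ψ t ≤ L * (t' - t) := by
  obtain ⟨l, M, hl, hM, h1, h2, hlip⟩ := h.exists_slope_bounds hψ
  have h3 := ae_abs_le_linftyNorm (Eventually.of_forall h1)
  have h4 := ae_abs_le_linftyNorm (f := fun t => 1 / deriv ψ t) (C := 1 / l)
    (h2.mono fun t ht => by
      rw [abs_of_pos (one_div_pos.2 (hl.trans_le ht))]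
      exact one_div_le_one_div_of_le hl ht)
  have h5 : ∀ᵐ t, 0 < deriv ψ t ∧ deriv ψ t ≤ L ∧ 1 / deriv ψ t ≤ L := by
    filter_upwards [h2, h3, h4] with t ht2 ht3 ht4
    rw [hL]
    exact ⟨hl.trans_le ht2, (le_abs_self _).trans (ht3.trans (le_max_left _ _)),
      (le_abs_self _).trans (ht4.trans (le_max_right _ _))⟩
  -- At some point both `ψ'` and its reciprocal are at most `L`.
  have hL1 : 1 ≤ L := by
    obtain ⟨t, ht1, ht2, ht3⟩ := h5.exists
    rw [div_le_iff₀ ht1] at ht3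
    nlinarith
  have h6 : ∀ᵐ t, 1 / L ≤ deriv ψ t ∧ deriv ψ t ≤ L :=
    h5.mono fun t ⟨ht1, ht2, ht3⟩ => ⟨(one_div_le ht1 (by linarith)).1 ht3, ht2⟩
  exact ⟨hL1, h6, fun t t' htt => hlip.mul_sub_le_of_ae_deriv h6 htt⟩

namespace IsRadialMap

variable {r ψ : ℝ → ℝ} {w : ℂ → ℂ} (h : IsRadialMap r ψ w)
include h

theorem isBiLipschitz_of_boundary {c C : ℝ} (hc : 0 < c)
    (hlow : ∀ t t' : ℝ, c * ‖exp (t' * I) - exp (t * I)‖ ≤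
      ‖polarPoint r (ψ t') - polarPoint r (ψ t)‖)
    (hup : ∀ t t' : ℝ, ‖polarPoint r (ψ t') - polarPoint r (ψ t)‖ ≤ C * |t' - t|) :
    IsBiLipschitz ψ := by
  obtain ⟨K, hK⟩ := h.abs_sub_le_of_boundary hup
  obtain ⟨K', hK'0, hK'⟩ := h.le_abs_sub_of_boundary hc hlow
  refine ⟨K', K, isBiLipschitzWith_of_slopes hK'0 fun t t' htt => ?_⟩
  have h1 := hK t t'
  have h2 := hK' t t'
  rw [abs_of_nonneg (sub_nonneg.2 htt),
    abs_of_nonneg (sub_nonneg.2 (h.strictMono.monotone htt))] at h1 h2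
  exact ⟨h2, h1⟩

/-- The non-sharp Lipschitz bound supplies absolute continuity of `ψ`; integrating the sharp bounds
on `ψ'` then gives the stated constants. -/
theorem isBiLipschitzWith_of_quasiconformal {k : ℝ}
    (hw : IsQuasiconformalWith k w (Metric.ball 0 1) (starlikeDomain r)) :
    IsBiLipschitzWith ((1 - k) / (1 + k)) ((1 + k) / (1 - k)) ψ := by
  obtain ⟨C, hC⟩ := h.exists_boundary_lipschitz hw
  obtain ⟨K, hK⟩ := h.abs_sub_le_of_boundary hC
  have hk := hw.nonneg
  have hk1 := hw.lt_one
  have hlip : LipschitzWith K.toNNReal ψ := LipschitzWith.of_dist_le_mul fun x y => by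
    rw [dist_comm, dist_comm x, Real.dist_eq, Real.dist_eq]
    exact (hK x y).trans (mul_le_mul_of_nonneg_right (Real.le_coe_toNNReal K) (abs_nonneg _))
  exact isBiLipschitzWith_of_slopes (div_pos (by linarith) (by linarith)) fun t t' htt =>
    hlip.mul_sub_le_of_ae_deriv ((h.ae_deriv_bounds hw).mono fun t ht => ⟨ht.1, ht.2.1⟩) htt

theorem norm_sub_bounds_of_slopes {L σ d b : ℝ} (hL : 1 ≤ L)
    (hψ : ∀ t t', t ≤ t' → 1 / L * (t' - t) ≤ ψ t' - ψ t ∧ ψ t' - ψ t ≤ L * (t' - t))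
    (hσ : 0 < σ) (hσ1 : σ ≤ 1) (hσr : ∀ s, σ ^ 2 * (r s ^ 2 + deriv r s ^ 2) ≤ r s ^ 2)
    (hd : 0 < d) (hdr : ∀ s, d ≤ r s) (hb : ∀ s, r s ≤ b) :
    0 < d ^ 2 / (L * (b * stretchBound σ L)) ∧ ∀ x y,
      d ^ 2 / (L * (b * stretchBound σ L)) * ‖y - x‖ ≤ ‖w y - w x‖ ∧
        ‖w y - w x‖ ≤ b * stretchBound σ L * ‖y - x‖ := by
  have hL0 : 0 < L := by linarith
  have hN : 0 < stretchBound σ L := by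
    have h1 := (stretchBound_sq hσ hσ1 hL).1
    have h2 : 0 ≤ stretchBound σ L := by rw [stretchBound]; positivity
    refine lt_of_le_of_ne h2 fun h3 => ?_
    rw [← h3] at h1
    linarith
  have hb0 : 0 < b := (h.pos 0).trans_le (hb 0)
  set M := b * stretchBound σ L with hM
  have hM0 : 0 < M := mul_pos hb0 hN
  have hl : 0 < d ^ 2 / (L * M) := by positivity
  refine ⟨hl, h.norm_sub_bounds hL hψ hl fun s lam ζ hlam hlam' => ?_⟩
  have hlam0 : 0 < lam := (one_div_pos.2 hL0).trans_le hlam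
  have hup : ∀ ζ, ‖radialDeriv r s lam ζ‖ ≤ M * ‖ζ‖ := fun ζ =>
    (norm_radialDeriv_le (h.pos s) hσ hσ1 (hσr s) hL hlam0 hlam' ζ).trans
      (mul_le_mul_of_nonneg_right (mul_le_mul_of_nonneg_right (hb s) hN.le) (norm_nonneg _))
  refine ⟨?_, hup ζ⟩
  rcases eq_or_ne ζ 0 with rfl | hζ
  · simp
  have hζ0 : 0 < ‖ζ‖ := norm_pos_iff.2 hζ
  have h1 := mul_norm_sq_le_norm_radialDeriv r s lam ζ
  have h2 := hup (I * ζ)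
  rw [norm_mul, norm_I, one_mul] at h2
  have h3 := h1.trans (mul_le_mul_of_nonneg_left h2 (norm_nonneg _))
  -- The determinant is at least `d² / L`; dividing by the upper bound `M` gives the lower constant.
  have h4 : 1 / L * d ^ 2 ≤ lam * r s ^ 2 :=
    mul_le_mul hlam (pow_le_pow_left₀ hd.le (hdr s) 2) (by positivity) hlam0.le
  have h5 : 1 / L * d ^ 2 * ‖ζ‖ ≤ ‖radialDeriv r s lam ζ‖ * M := by
    have h6 := mul_le_mul_of_nonneg_right h4 (sq_nonneg ‖ζ‖)
    refine le_of_mul_le_mul_right ?_ hζ0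
    nlinarith
  have h7 : d ^ 2 / (L * M) * ‖ζ‖ = 1 / L * d ^ 2 * ‖ζ‖ / M := by field_simp
  rwa [h7, div_le_iff₀ hM0]

end IsRadialMap

theorem isBiLipschitzWith_domRestrict {w : ℂ → ℂ} {l M : ℝ} (hl : 0 < l)
    (hw : ∀ x y, l * ‖y - x‖ ≤ ‖w y - w x‖ ∧ ‖w y - w x‖ ≤ M * ‖y - x‖) (s : Set ℂ) :
    IsBiLipschitzWith l M (s.domRestrict w) := by
  refine ⟨hl, ?_, fun x y => ?_⟩
  · have := hw 0 1
    rw [sub_zero, norm_one, mul_one, mul_one] at this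
    exact this.1.trans this.2
  · have := hw y x
    rwa [← dist_eq_norm, ← dist_eq_norm] at this

theorem infDist_zero_curve {γ : Set ℂ} {r : ℝ → ℝ} (hγ : IsSmoothStarlikeCurve γ r) {a : ℝ}
    (ha : 0 < a) (har : ∀ s, a ≤ r s) :
    0 < Metric.infDist 0 γ ∧ ∀ s, Metric.infDist 0 γ ≤ r s := by
  have hmem : ∀ s, polarPoint r s ∈ γ := fun s => by rw [hγ.curve_eq]; exact ⟨s, rfl⟩
  have hdist : ∀ s, dist 0 (polarPoint r s) = r s := fun s => by
    rw [dist_zero_left, norm_polarPoint hγ.pos]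
  refine ⟨ha.trans_le ((Metric.le_infDist ⟨_, hmem 0⟩).2 fun y hy => ?_), fun s => ?_⟩
  · rw [hγ.curve_eq] at hy
    obtain ⟨s, rfl⟩ := hy
    exact (har s).trans_eq (hdist s).symm
  · rw [← hdist s]
    exact Metric.infDist_le_dist_of_mem (hmem s)

theorem le_linftyNorm_of_continuous {f : ℝ → ℝ} (hf : Continuous f) {C : ℝ}
    (hC : ∀ t, |f t| ≤ C) (t : ℝ) : f t ≤ linftyNorm f := by
  have h1 : (fun t => max (f t) (linftyNorm f)) =ᵐ[volume] fun _ => linftyNorm f :=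
    (ae_abs_le_linftyNorm (Eventually.of_forall hC)).mono fun t ht =>
      max_eq_right ((le_abs_self _).trans ht)
  have h2 := Measure.eq_of_ae_eq h1 (by fun_prop) (by fun_prop)
  exact max_eq_right_iff.1 (congrFun h2 t)

end Main

end
theorem mainTheorem5 (γ : Set ℂ) (r : ℝ → ℝ) (hγ : IsSmoothStarlikeCurve γ r)
    (G : Circle ≃ₜ γ) (ρ ψ : ℝ → ℝ) (hρ : ∀ t, 0 < ρ t) (hψ : Continuous ψ)
    (hG : ∀ t : ℝ, (G (Circle.exp t) : ℂ) = ρ t * Complex.exp (ψ t * Complex.I))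
    (hor : Monotone ψ)
    (w : ℂ → ℂ) (hw : w = radialExtension (fun u => (G u : ℂ)))
    (L : ℝ) (hL : L = max (linftyNorm (deriv ψ)) (linftyNorm (fun t => 1 / deriv ψ t)))
    (α : ℝ) (hα : α = tangentAngle r)
    (M : ℝ) (hM : M = linftyNorm ρ / (2 * Real.sin α) *
      (Real.sqrt (L ^ 2 + Real.sin α ^ 2 * (1 - 2 * L)) +
        Real.sqrt (L ^ 2 + Real.sin α ^ 2 * (1 + 2 * L)))) :
    List.TFAE [
      IsBiLipschitz G,
      IsBiLipschitz ψ,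
      IsBiLipschitz ((Metric.ball (0 : ℂ) 1).domRestrict w),
      IsQuasiconformal w (Metric.ball 0 1) (starlikeDomain r)] ∧
    (IsBiLipschitz ψ →
      IsBiLipschitzWith (Metric.infDist 0 γ ^ 2 / (L * M)) M
        ((Metric.ball (0 : ℂ) 1).domRestrict w) ∧
      IsQuasiconformalWith
        (Real.sqrt ((L ^ 2 + Real.sin α ^ 2 * (1 - 2 * L)) /
          (L ^ 2 + Real.sin α ^ 2 * (1 + 2 * L))))
        w (Metric.ball 0 1) (starlikeDomain r)) ∧
    (∀ k : ℝ, IsQuasiconformalWith k w (Metric.ball 0 1) (starlikeDomain r) →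
      IsBiLipschitzWith ((1 - k) / (1 + k)) ((1 + k) / (1 - k)) ψ ∧
      (1 - k) / (1 + k) ≤ Real.sin α) := by
  have h : IsRadialMap r ψ w := hw ▸ isRadialMap_radialExtension hγ G hρ hψ hG hor
  have hρr := radius_eq_comp hγ G hρ hG
  have hGp : ∀ t : ℝ, (G (Circle.exp t) : ℂ) = polarPoint r (ψ t) := fun t => by
    rw [hG, hρr, polarPoint]
  obtain ⟨a, b, ha, hab⟩ := h.exists_radius_bounds
  have hρL : ∀ s, r s ≤ linftyNorm ρ := by
    intro s
    obtain ⟨t, rfl⟩ := h.surj s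
    rw [← hρr]
    refine le_linftyNorm_of_continuous ?_ (C := b) (fun t => ?_) t
    · rw [funext hρr]; exact h.smooth.continuous.comp hψ
    · rw [abs_of_pos (hρ t), hρr]; exact (hab _).2
  have hσ := sin_tangentAngle_pos h.smooth h.pos h.periodic
  have hσr := sin_tangentAngle_sq_mul_le h.smooth h.pos h.periodic
  rw [← hα] at hσ hσr
  have hM' : M = linftyNorm ρ * stretchBound (Real.sin α) L := by
    rw [hM, stretchBound]; ring
  obtain ⟨hd, hdr⟩ := infDist_zero_curve hγ ha fun s => (hab s).1
  have hforward : IsBiLipschitz ψ →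
      IsBiLipschitzWith (Metric.infDist 0 γ ^ 2 / (L * M)) M
        ((Metric.ball (0 : ℂ) 1).domRestrict w) ∧
      IsQuasiconformalWith
        (Real.sqrt ((L ^ 2 + Real.sin α ^ 2 * (1 - 2 * L)) /
          (L ^ 2 + Real.sin α ^ 2 * (1 + 2 * L))))
        w (Metric.ball 0 1) (starlikeDomain r) := by
    intro hb
    obtain ⟨hL1, hae, hslope⟩ := hb.deriv_bounds hor hL
    obtain ⟨hl, hbd⟩ := h.norm_sub_bounds_of_slopes hL1 hslope hσ (Real.sin_le_one α) hσr hd hdr hρL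
    rw [← hM'] at hl hbd
    exact ⟨isBiLipschitzWith_domRestrict hl hbd _,
      h.isQuasiconformalWith hL1 hσ (Real.sin_le_one α) hσr hae fun x y => (hbd x y).2⟩
  refine ⟨?_, hforward, fun k hk => ⟨h.isBiLipschitzWith_of_quasiconformal hk,
    hα ▸ h.le_sin_of_quasiconformal hk⟩⟩
  tfae_have 1 → 2 := by
    rintro ⟨l, K, hl, hlK, hlip⟩
    have hdist : ∀ t t' : ℝ, dist (G (Circle.exp t')) (G (Circle.exp t)) =
        ‖polarPoint r (ψ t') - polarPoint r (ψ t)‖ := fun t t' => by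
      rw [Subtype.dist_eq, hGp, hGp, dist_eq_norm]
    have hdist' : ∀ t t' : ℝ, dist (Circle.exp t') (Circle.exp t) =
        ‖Complex.exp (t' * Complex.I) - Complex.exp (t * Complex.I)‖ := fun t t' => by
      rw [← Circle.coe_exp, ← Circle.coe_exp, ← dist_eq_norm]; rfl
    refine h.isBiLipschitz_of_boundary (C := K) hl (fun t t' => ?_) fun t t' => ?_
    · rw [← hdist, ← hdist']; exact (hlip _ _).1
    · rw [← hdist]
      refine (hlip _ _).2.trans (mul_le_mul_of_nonneg_left ?_ (hl.le.trans hlK))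
      rw [hdist']
      exact norm_exp_sub_exp_le t t'
  tfae_have 2 → 3 := fun hb => ⟨_, _, (hforward hb).1⟩
  tfae_have 3 → 1 := by
    rintro ⟨l, K, hl, hlK, hlip⟩
    refine ⟨l, K, hl, hlK, fun u v => ?_⟩
    -- The boundary circle is not in the open disk, so its copy of radius 1/2 is used; homogeneity
    -- puts the factor 1/2 on both sides and the constants survive.
    have hball : ∀ t : ℝ, ((1 / 2 : ℝ) : ℂ) * Complex.exp (t * Complex.I) ∈
        Metric.ball (0 : ℂ) 1 := fun t => by
      rw [mem_ball_zero_iff, norm_polar (by norm_num)]; norm_num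
    obtain ⟨t, rfl⟩ := Circle.exp_surjective u
    obtain ⟨t', rfl⟩ := Circle.exp_surjective v
    have h1 := hlip ⟨_, hball t⟩ ⟨_, hball t'⟩
    simp only [Subtype.dist_eq, domRestrict_apply, dist_eq_norm,
      h.apply_polar _ _ (by norm_num : (0 : ℝ) ≤ 1 / 2), ← mul_sub, norm_mul, Complex.norm_real,
      Real.norm_of_nonneg (by norm_num : (0 : ℝ) ≤ 1 / 2)] at h1
    have h2 : dist (Circle.exp t) (Circle.exp t') =
        ‖Complex.exp (t * Complex.I) - Complex.exp (t' * Complex.I)‖ := by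
      rw [← Circle.coe_exp, ← Circle.coe_exp, ← dist_eq_norm]; rfl
    rw [Subtype.dist_eq, hGp, hGp, dist_eq_norm, h2]
    constructor <;> linarith [h1.1, h1.2]
  tfae_have 2 → 4 := fun hb => ⟨_, (hforward hb).2⟩
  tfae_have 4 → 2 := fun ⟨k, hk⟩ => ⟨_, _, h.isBiLipschitzWith_of_quasiconformal hk⟩
  tfae_finish
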